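/- Let $G=\mathrm{PSL}(2,\mathbb C)$, regarded as a discrete group, and let $P\le G$ be the image of the group of upper triangular matrices with $1$ on the diagonal. For $n\ge 1$ let $\bar C_n(G,P)$ be the free abelian group generated by the families $\{g^{ij}\}$ of elements of $G$, indexed by the ordered pairs of distinct $i,j\in\{0,\dots,n\}$ (labelings of the vertices $ij$ of a truncated $n$-simplex), such that (i) for each fixed $i$ the elements $g^{ij}$, $j\ne i$, are pairwise distinct and lie in the same left coset of $P$; and (ii) for all $i\neq j$ the element $(g^{ij})^{-1}g^{ji}$ is counter-diagonal, i.e. is represented by a matrix $\begin{pmatrix}0&-a^{-1}\\a&0\end{pmatrix}$ with $a\neq0$. Put $\bar C_0(G,P)=0$. Let $G$ act by left multiplication on all labels, and let $\partial\colon\bar C_n(G,P)\to\bar C_{n-1}(G,P)$, $n\ge2$, be the alternating sum $\sum_k(-1)^k d_k$, where $d_k$ deletes all labels $g^{ij}$ with $k\in\{i,j\}$. This makes $\bar C_*(G,P)$ a chain complex of $\mathbb Z[G]$-modules. Let $K$ be the kernel of the augmentation $\mathbb Z[G/P]\to\mathbb Z$, and let $\pi\colon\bar C_1(G,P)\to K$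 be the $G$-map sending a generator $\{g^{01},g^{10}\}$ to $g^{10}P-g^{01}P$. Then $\bar C_*(G,P)$ is a free $G$-resolution of $K$: every $\bar C_n(G,P)$ is a free $\mathbb Z[G]$-module, and the sequence $$\cdots\to\bar C_3(G,P)\xrightarrow{\partial}\bar C_2(G,P)\xrightarrow{\partial}\bar C_1(G,P)\xrightarrow{\pi}K\to0$$ is exact. Moreover, if $\bar B_*(G,P)=\bar C_*(G,P)\otimes_{\mathbb Z[G]}\mathbb Z$, then for every $n\geq 0$ there is an isomorphism $$H_n(\bar B_*(G,P))\cong H_n(G,P),$$ where $H_n(G,P)=H_n(BG,BP;\mathbb Z)$ is the relative singular homology of the pair of classifying spaces $BP\subset BG$, realized as the geometric realizations of the nerves of $P$ and $G$. -/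

import Mathlib

open CategoryTheory
open scoped MatrixGroups

noncomputable section

namespace TruncatedComplex

/-! ### Relative homology of a (discrete) group and a subgroup -/

/-- The classifying space `BG` of a discrete group `G`: the geometric realization of the nerve of
the one-object category `G`. -/
def classifyingSpace (G : Type) [Group G] : TopCat.{0} :=
  SSet.toTop.{0}.obj (nerve (SingleObj G))

/-- The map `BH → BG` induced by the inclusion of a subgroup; it identifies `BH` with the
realization of a simplicial subset of the nerve of `G`, i.e. with a subspace of `BG`. -/
def classifyingSpaceInclusion (G : Type) [Group G] (H : Subgroup G) :
    classifyingSpace H ⟶ classifyingSpace G :=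
  SSet.toTop.{0}.map (nerveMap H.subtype.toFunctor)

/-- The integral singular chain complex of a space. -/
abbrev singularChains : TopCat.{0} ⥤ ChainComplex (ModuleCat.{0} ℤ) ℕ :=
  (AlgebraicTopology.singularChainComplexFunctor (ModuleCat.{0} ℤ)).obj (ModuleCat.of ℤ ℤ)

/-- The relative singular chain complex `S_*(BG) / S_*(BH)`. -/
def relativeChains (G : Type) [Group G] (H : Subgroup G) : ChainComplex (ModuleCat.{0} ℤ) ℕ :=
  Limits.cokernel (singularChains.map (classifyingSpaceInclusion G H))

/-- The relative homology `H_n(G, H) = H_n(BG, BH; ℤ)`. -/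
def relativeHomology (G : Type) [Group G] (H : Subgroup G) (n : ℕ) : ModuleCat.{0} ℤ :=
  (relativeChains G H).homology n

/-! ### The group `PSL(2, ℂ)`, the subgroup `P` and counter-diagonal elements -/

/-- `G = PSL(2, ℂ)`. -/
abbrev G : Type := PSL(2, ℂ)

/-- `[[1, x], [0, 1]]` in `SL(2, ℂ)`. -/
def unipotent (x : ℂ) : SL(2, ℂ) := ⟨!![1, x; 0, 1], by simp⟩

lemma unipotent_zero : unipotent 0 = 1 := by
  apply Subtype.ext
  ext i j
  fin_cases i <;> fin_cases j <;> simp [unipotent]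

lemma unipotent_mul (x y : ℂ) : unipotent x * unipotent y = unipotent (x + y) := by
  apply Subtype.ext
  ext i j
  rw [Matrix.SpecialLinearGroup.coe_mul]
  fin_cases i <;> fin_cases j <;> simp [unipotent, add_comm]

/-- The image `P` in `PSL(2, ℂ)` of the group of upper triangular matrices with `1` on the
diagonal. -/
def P : Subgroup G where
  carrier := {g | ∃ x : ℂ, g = (unipotent x : G)}
  one_mem' := ⟨0, by rw [unipotent_zero]; rfl⟩
  mul_mem' := by
    rintro _ _ ⟨x, rfl⟩ ⟨y, rfl⟩
    exact ⟨x + y, by rw [← unipotent_mul]; rfl⟩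
  inv_mem' := by
    rintro _ ⟨x, rfl⟩
    refine ⟨-x, inv_eq_of_mul_eq_one_right ?_⟩
    rw [← QuotientGroup.mk_mul, unipotent_mul, add_neg_cancel, unipotent_zero]
    rfl

/-- `[[0, -a⁻¹], [a, 0]]` in `SL(2, ℂ)`, for `a ≠ 0`. -/
def counterDiagonal (a : ℂ) (ha : a ≠ 0) : SL(2, ℂ) :=
  ⟨!![0, -a⁻¹; a, 0], by simp [ha]⟩

/-- An element of `PSL(2, ℂ)` is counter-diagonal if it is the class of a matrix
`[[0, -a⁻¹], [a, 0]]`. -/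
def IsCounterDiagonal (g : G) : Prop :=
  ∃ (a : ℂ) (ha : a ≠ 0), g = (counterDiagonal a ha : G)

/-! ### The complex of truncated simplices -/

/-- The generators of `C̄_n(G, P)`, `n ≥ 1`: `G`-labelings `g^{ij}` (`i ≠ j`) of the vertices of a
truncated `n`-simplex such that

* for fixed `i` the labels `g^{ij}` are distinct and lie in one left `P`-coset;
* `(g^{ij})⁻¹ g^{ji}` is counter-diagonal.

There are no generators for `n = 0`. -/
@[ext]
structure Generator (n : ℕ) where
  label : ∀ i j : Fin (n + 1), i ≠ j → G
  pos : 1 ≤ n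
  coset : ∀ i j k (hj : i ≠ j) (hk : i ≠ k),
    (label i j hj : G ⧸ P) = (label i k hk : G ⧸ P)
  distinct : ∀ i j k (hj : i ≠ j) (hk : i ≠ k), j ≠ k → label i j hj ≠ label i k hk
  counter : ∀ i j (h : i ≠ j), IsCounterDiagonal ((label i j h)⁻¹ * label j i h.symm)

namespace Generator

/-- `G` acts on labelings by left multiplication of all labels. -/
instance (n : ℕ) : MulAction G (Generator n) where
  smul g α :=
    { label := fun i j h => g * α.label i j h
      pos := α.pos
      coset := fun i j k hj hk => by
        have h := congrArg (g • ·) (α.coset i j k hj hk)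
        simpa using h
      distinct := fun i j k hj hk hjk h => α.distinct i j k hj hk hjk (mul_left_cancel h)
      counter := fun i j h => by
        have := α.counter i j h
        rwa [mul_inv_rev, mul_assoc, inv_mul_cancel_left] }
  one_smul α := by
    apply Generator.ext
    funext i j h
    exact one_mul _
  mul_smul g g' α := by
    apply Generator.ext
    funext i j h
    exact mul_assoc _ _ _

@[simp]
lemma smul_label {n : ℕ} (g : G) (α : Generator n) (i j : Fin (n + 1)) (h : i ≠ j) :
    (g • α).label i j h = g * α.label i j h := rfl

/-- The `k`-th face: delete the `k`-th vertex of the untruncated simplex and keep the labels. -/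
def face {n : ℕ} (k : Fin (n + 3)) (α : Generator (n + 2)) : Generator (n + 1) where
  label i j h := α.label (k.succAbove i) (k.succAbove j) (k.succAbove_right_injective.ne h)
  pos := Nat.succ_le_succ (Nat.zero_le n)
  coset _ _ _ _ _ := α.coset _ _ _ _ _
  distinct _ _ _ _ _ hjk := α.distinct _ _ _ _ _ (k.succAbove_right_injective.ne hjk)
  counter _ _ _ := α.counter _ _ _

lemma face_smul {n : ℕ} (k : Fin (n + 3)) (g : G) (α : Generator (n + 2)) :
    face k (g • α) = g • face k α := rfl

lemma face_face {n : ℕ} (α : Generator (n + 3)) (i : Fin (n + 3)) (j : Fin (n + 4))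
    (H : j ≤ i.castSucc) :
    face i (face j α) = face (j.castLT (lt_of_le_of_lt H i.is_lt)) (face i.succ α) := by
  have key : ∀ a : Fin (n + 2), j.succAbove (i.succAbove a) =
      i.succ.succAbove ((j.castLT (lt_of_le_of_lt H i.is_lt)).succAbove a) := by
    intro a
    rw [Fin.le_def] at H
    simp only [Fin.val_castSucc] at H
    apply Fin.ext
    simp only [Fin.succAbove, Fin.lt_def, Fin.val_castSucc, Fin.val_succ, Fin.val_castLT]
    split_ifs <;> simp_all <;> omega
  apply Generator.ext
  funext a b h
  simp only [face, key]

/-- The left `P`-coset of the labels near the `i`-th vertex of a generator of `C̄_1(G, P)`. -/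
def cosetOfEdge (α : Generator 1) : Fin 2 → G ⧸ P
  | 0 => (α.label 0 1 (by decide) : G ⧸ P)
  | 1 => (α.label 1 0 (by decide) : G ⧸ P)

end Generator

/-- `C̄_n(G, P)`: the free abelian group on the generators, with `G` acting by left
multiplication. It is zero for `n = 0`. -/
abbrev chains (n : ℕ) : Rep.{0} ℤ G := Rep.ofMulAction ℤ G (Generator n)

/-- The morphism of `G`-modules `ℤ[X] → ℤ[Y]` induced by a `G`-map `X → Y`. -/
def mapRep {X Y : Type} [MulAction G X] [MulAction G Y] (f : X → Y)
    (hf : ∀ (g : G) (x : X), f (g • x) = g • f x) :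
    Rep.ofMulAction ℤ G X ⟶ Rep.ofMulAction ℤ G Y :=
  (Rep.linearization ℤ G).map
    (X := Action.ofMulAction G X) (Y := Action.ofMulAction G Y)
    { hom := ↾f, comm := fun g => by ext x; exact hf g x }

lemma mapRep_single {X Y : Type} [MulAction G X] [MulAction G Y] (f : X → Y)
    (hf : ∀ (g : G) (x : X), f (g • x) = g • f x) (x : X) (r : ℤ) :
    (mapRep f hf).hom (MonoidAlgebra.single x r) = MonoidAlgebra.single (f x) r :=
  Representation.linearizeMap_single _ _ _

lemma mapRep_comp {X Y Z : Type} [MulAction G X] [MulAction G Y] [MulAction G Z] (f : X → Y)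
    (hf : ∀ (g : G) (x : X), f (g • x) = g • f x) (f' : Y → Z)
    (hf' : ∀ (g : G) (y : Y), f' (g • y) = g • f' y) :
    mapRep f hf ≫ mapRep f' hf' = mapRep (f' ∘ f) (fun g x => by simp [hf, hf']) :=
  ((Rep.linearization ℤ G).map_comp (X := Action.ofMulAction G X) (Y := Action.ofMulAction G Y)
    (Z := Action.ofMulAction G Z) _ _).symm

/-- The face maps `C̄_{n+2}(G, P) → C̄_{n+1}(G, P)`. -/
def faceMap (n : ℕ) (k : Fin (n + 3)) : chains (n + 2) ⟶ chains (n + 1) :=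
  mapRep (Generator.face k) (Generator.face_smul k)

/-- The boundary map: the alternating sum of the faces (and zero on `C̄_1(G, P)`). -/
def boundary : ∀ n : ℕ, chains (n + 1) ⟶ chains n
  | 0 => 0
  | n + 1 => ∑ k : Fin (n + 3), (-1 : ℤ) ^ (k : ℕ) • faceMap n k

lemma faceMap_comp (n : ℕ) (i : Fin (n + 3)) (j : Fin (n + 4)) (H : j ≤ i.castSucc) :
    faceMap (n + 1) j ≫ faceMap n i =
      faceMap (n + 1) i.succ ≫ faceMap n (j.castLT (lt_of_le_of_lt H i.is_lt)) := by
  simp only [faceMap, mapRep_comp]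
  congr 1
  funext α
  exact Generator.face_face α i j H

lemma boundary_comp (n : ℕ) : boundary (n + 1) ≫ boundary n = 0 := by
  cases n with
  | zero => simp [boundary]
  | succ n =>
    simp only [boundary, Preadditive.comp_sum, Preadditive.sum_comp, ← Finset.sum_product']
    let Q := Fin (n + 3) × Fin (n + 4)
    let S : Finset Q := {ij : Q | (ij.2 : ℕ) ≤ (ij.1 : ℕ)}
    rw [Finset.univ_product_univ, ← Finset.sum_add_sum_compl S, ← eq_neg_iff_add_eq_zero,
      ← Finset.sum_neg_distrib]
    let φ : ∀ ij : Q, ij ∈ S → Q := fun ij hij =>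
      (Fin.castLT ij.2 (lt_of_le_of_lt (Finset.mem_filter.mp hij).right (Fin.is_lt ij.1)),
        ij.1.succ)
    apply Finset.sum_bij φ
    · intro ij hij
      simp_rw [S, φ, Finset.compl_filter, Finset.mem_filter_univ, Fin.val_succ,
        Fin.val_castLT] at hij ⊢
      lia
    · rintro ⟨i, j⟩ hij ⟨i', j'⟩ hij' h
      rw [Prod.mk_inj]
      exact ⟨by simpa [φ] using! congr_arg Prod.snd h,
        by simpa [φ, Fin.castSucc_castLT] using! congr_arg Fin.castSucc (congr_arg Prod.fst h)⟩
    · rintro ⟨i', j'⟩ hij'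
      simp_rw [S, Finset.compl_filter, Finset.mem_filter_univ, not_le] at hij'
      refine ⟨(j'.pred <| ?_, Fin.castSucc i'), ?_, ?_⟩
      · rintro rfl
        simp only [Fin.val_zero, not_lt_zero] at hij'
      · simpa [S] using! Nat.le_sub_one_of_lt hij'
      · simp only [φ, Fin.castLT_castSucc, Fin.succ_pred]
    · rintro ⟨i, j⟩ hij
      dsimp
      simp only [Preadditive.zsmul_comp, Preadditive.comp_zsmul, smul_smul, ← neg_smul]
      congr 1
      · simp only [φ, Fin.val_succ, pow_add, pow_one, mul_neg, neg_neg, mul_one]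
        apply mul_comm
      · exact faceMap_comp n i j (by simpa [S] using! hij)

/-- The complex `C̄_*(G, P)` of `G`-modules. -/
def Cbar : ChainComplex (Rep.{0} ℤ G) ℕ := ChainComplex.of chains boundary boundary_comp

/-- The complex `B̄_*(G, P) = C̄_*(G, P) ⊗_{ℤ[G]} ℤ`, i.e. the complex of `G`-coinvariants. -/
def Bbar : ChainComplex (ModuleCat.{0} ℤ) ℕ :=
  ((Rep.coinvariantsFunctor ℤ G).mapHomologicalComplex _).obj Cbar

/-! ### The augmentation kernel -/

/-- `C_0(G/P)`: the free abelian group on the left cosets of `P`. -/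
abbrev cosetChains : Rep.{0} ℤ G := Rep.ofMulAction ℤ G (G ⧸ P)

/-- The augmentation `C_0(G/P) → ℤ`, the sum of the coefficients. -/
def augmentation : cosetChains ⟶ Rep.trivial ℤ G ℤ :=
  Rep.ofHom
    ⟨(Finsupp.linearCombination ℤ fun _ => (1 : ℤ)) ∘ₗ
      (MonoidAlgebra.coeffLinearEquiv ℤ).toLinearMap,
      fun _ => MonoidAlgebra.lhom_ext' fun _ => LinearMap.ext_ring <| by simp⟩

lemma augmentation_single (x : G ⧸ P) (r : ℤ) :
    augmentation.hom (MonoidAlgebra.single x r) = r := by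
  change (Finsupp.linearCombination ℤ fun _ => (1 : ℤ)) (Finsupp.single x r) = r
  simp

/-- The kernel `K` of the augmentation, as a `G`-module. -/
def K : Rep.{0} ℤ G :=
  Rep.subrepresentation cosetChains (LinearMap.ker augmentation.hom.toLinearMap) (by
    intro g x hx
    have hx' : augmentation.hom x = 0 := hx
    change augmentation.hom (cosetChains.ρ g x) = 0
    rw [Rep.hom_comm_apply, hx', map_zero])

/-- The map `C̄_1(G, P) → C_0(G/P)` induced by the boundary of a `1`-simplex: a generator is sent
to the coset at its vertex `1` minus the coset at its vertex `0`. -/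
def edgeMap : chains 1 ⟶ cosetChains :=
  mapRep (fun α : Generator 1 => α.cosetOfEdge 1) (fun _ _ => rfl) -
    mapRep (fun α : Generator 1 => α.cosetOfEdge 0) (fun _ _ => rfl)

lemma edgeMap_single (α : Generator 1) (r : ℤ) :
    edgeMap.hom (MonoidAlgebra.single α r) =
      MonoidAlgebra.single (α.cosetOfEdge 1) r - MonoidAlgebra.single (α.cosetOfEdge 0) r := by
  exact congrArg₂ (· - ·) (mapRep_single (fun α : Generator 1 => α.cosetOfEdge 1) _ α r)
    (mapRep_single (fun α : Generator 1 => α.cosetOfEdge 0) _ α r)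

lemma augmentation_edgeMap (x : chains 1) : augmentation.hom (edgeMap.hom x) = 0 := by
  have h : augmentation.hom.toLinearMap ∘ₗ edgeMap.hom.toLinearMap = 0 := by
    refine MonoidAlgebra.lhom_ext' fun α => LinearMap.ext_ring ?_
    change augmentation.hom (edgeMap.hom (MonoidAlgebra.single α 1)) = 0
    rw [edgeMap_single, map_sub, augmentation_single, augmentation_single, sub_self]
  exact LinearMap.congr_fun h x

/-- The map `C̄_1(G, P) → K` induced by the boundary. -/
def toK : Cbar.X 1 ⟶ K :=
  Rep.ofHom (ρ := (chains 1).ρ)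
    ⟨edgeMap.hom.toLinearMap.codRestrict _ augmentation_edgeMap, fun g => by
      refine LinearMap.ext fun x => Subtype.ext ?_
      exact Rep.hom_comm_apply edgeMap g x⟩

end TruncatedComplex

end

/-! Left cosets of `P` correspond to nonzero vectors of ℂ² up to sign. Two cosets in general
position (linearly independent vectors) contain exactly one pair a, b with a⁻¹b counter-diagonal:
existence is the big Bruhat cell (`exists_isCounterDiagonal_mul`), uniqueness is
`eq_and_eq_of_isCounterDiagonal`. So a labeling amounts to an (n+1)-tuple of cosets in pairwise
general position; distinctness of the labels at a vertex is automatic (`Generic.edgeLabel_ne`). Left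
multiplication is free on labels, hence the chain modules are free. Any finite set of cosets admits
a common generic coset U (`exists_generic`), and coning with vertex U contracts any given chain,
which gives exactness.

For the homology, let EG be the realization of `tuples G`, a contractible space with a free action
and with BG as quotient covering. The translates gEP are disjoint and indexed by G/P. The chains D
of EG relative to the union of these translates form a complex of projectives whose coinvariants are
the relative chains of (BG, BP) (`nonempty_relativeChains_iso`). Since EG is contractible and the
union of translates deforms onto the discrete set G/P, the homology of D is K, placed in degree 1.

Instead of computing this homology group, the proof extends the identification of the 1-cycles
modulo boundaries with K to a G-map D₁ → K defined on all of D₁ (`relativeToK`), and shows D₂ → D₁ →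
D₀ ⊕ K → 0 exact. The extension uses an equivariant labeling of the points of EG by elements of G.
It is discontinuous, but its coset is constant along paths inside a translate, which is enough.

Two nonnegative complexes of projectives with the same homology concentrated in degree 1 are then
homotopy equivalent (`ChainComplex.exists_quasiIso_of_homology_concentrated_in_one`), and taking
coinvariants preserves homotopy equivalences. -/

section

/-! ### Complexes of projectives with one non-zero homology object -/

namespace ChainComplex

open Limits

variable {A : Type*} [Category* A] [Abelian A]

/-- A morphism in degree `0` lifts along an exact augmented complex. -/
lemma exists_hom_of_exact (X Y : ChainComplex A ℕ) [∀ n, Projective (X.X (n + 1))]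
    [Epi (Y.d 1 0)]
    (hY : ∀ n, (ShortComplex.mk (Y.d (n + 2) (n + 1)) (Y.d (n + 1) n) (Y.d_comp_d _ _ _)).Exact)
    (f : X.X 0 ⟶ Y.X 0) : ∃ φ : X ⟶ Y, φ.f 0 = f := by
  refine ⟨mkHom X Y f (Projective.factorThru (X.d 1 0 ≫ f) (Y.d 1 0)) (by simp)
    fun n p => ⟨(hY n).liftFromProjective (X.d (n + 2) (n + 1) ≫ p.2.1) ?_,
      (hY n).liftFromProjective_comp _ _⟩, rfl⟩
  simp [p.2.2]

variable {C D : ChainComplex A ℕ} {K : A}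

/-- If the homology of two chain complexes `C` and `D` is concentrated in degree `1`, where it is
`K`, and `C` vanishes in degree `0` and is projective in positive degrees, then there is a
quasi-isomorphism between them. -/
lemma exists_quasiIso_of_homology_concentrated_in_one
    [∀ n, Projective (C.X n)] (hC₀ : IsZero (C.X 0))
    (c : C.X 1 ⟶ K) [Epi c] (wc : C.d 2 1 ≫ c = 0) (hC₁ : (ShortComplex.mk _ _ wc).Exact)
    (hC : ∀ n, (ShortComplex.mk (C.d (n + 3) (n + 2)) (C.d (n + 2) (n + 1))
      (C.d_comp_d _ _ _)).Exact)
    (κ : D.X 1 ⟶ K) [Epi (biprod.lift (D.d 1 0) κ)]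
    (wD : D.d 2 1 ≫ biprod.lift (D.d 1 0) κ = 0) (hD₁ : (ShortComplex.mk _ _ wD).Exact)
    (hD : ∀ n, (ShortComplex.mk (D.d (n + 3) (n + 2)) (D.d (n + 2) (n + 1))
      (D.d_comp_d _ _ _)).Exact) :
    ∃ φ : C ⟶ D, QuasiIso φ := by
  -- Truncating and augmenting changes only degree 0: `X` has K there in place of C₀, and `Y` has D₀
  -- ⊕ K in place of D₀. Both are then exact in the range needed to lift the inclusion K → D₀ ⊕ K;
  -- its two components say that the lift lands in the cycles of D₁ and is compatible with the maps
  -- to K.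
  let X : ChainComplex A ℕ := augment (truncate.obj C) (X := K) c wc
  let Y : ChainComplex A ℕ :=
    augment (truncate.obj D) (X := D.X 0 ⊞ K) (biprod.lift (D.d 1 0) κ) wD
  have : ∀ n, Projective (X.X (n + 1)) := fun n => inferInstanceAs (Projective (C.X (n + 1)))
  have : Epi (Y.d 1 0) := ‹Epi (biprod.lift (D.d 1 0) κ)›
  obtain ⟨ψ, hψ⟩ := exists_hom_of_exact X Y
    (fun n => match n with
      | 0 => hD₁
      | n + 1 => hD n) (biprod.inr : K ⟶ D.X 0 ⊞ K)
  let f : ∀ n, C.X n ⟶ D.X n := fun n => match n with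
    | 0 => 0
    | n + 1 => ψ.f (n + 1)
  have h₁ : f 1 ≫ biprod.lift (D.d 1 0) κ = c ≫ biprod.inr := by
    rw [← hψ]
    exact ψ.comm 1 0
  have h₁' : f 1 ≫ D.d 1 0 = 0 := by simpa using h₁ =≫ biprod.fst
  have h₁'' : f 1 ≫ κ = c := by simpa using h₁ =≫ biprod.snd
  let φ : C ⟶ D :=
    { f := f
      comm' := by
        rintro i j (rfl : j + 1 = i)
        match j with
        | 0 => exact h₁'.trans comp_zero.symm
        | j + 1 => exact ψ.comm (j + 2) (j + 1) }
  refine ⟨φ, ⟨fun n => ?_⟩⟩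
  have exactAt : ∀ (Z : ChainComplex A ℕ) (n : ℕ), (ShortComplex.mk (Z.d (n + 3) (n + 2))
      (Z.d (n + 2) (n + 1)) (Z.d_comp_d _ _ _)).Exact → Z.ExactAt (n + 2) := fun Z n h => by
    rw [Z.exactAt_iff' (n + 3) (n + 2) (n + 1) (by simp) (by simp)]
    exact h
  match n with
  | 0 =>
    have hd : Epi (D.d 1 0) := by
      have : D.d 1 0 = biprod.lift (D.d 1 0) κ ≫ biprod.fst := by simp
      rw [this]
      infer_instance
    rw [quasiIsoAt_iff_exactAt]
    · rw [HomologicalComplex.exactAt_iff' _ 1 0 0 (by simp) (by simp),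
        ShortComplex.exact_iff_epi _ (D.shape _ _ (by simp))]
      exact hd
    · rw [HomologicalComplex.exactAt_iff_isZero_homology]
      exact ShortComplex.isZero_homology_of_isZero_X₂ _ hC₀
  | 1 =>
    have hm : Mono (HomologicalComplex.homologyMap φ 1) := by
      rw [HomologicalComplex.mono_homologyMap_iff_up_to_refinements φ 2 1 0 (by simp) (by simp)]
      -- If x becomes a boundary in D₁, then `κ` kills its image, so `c` kills x and x bounds in C.
      intro T x _ y hy
      refine hC₁.exact_up_to_refinements x ?_
      change x ≫ f 1 = _ at hy
      have := congr($wD ≫ biprod.snd)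
      simp only [Category.assoc, biprod.lift_snd, zero_comp] at this
      simp [← h₁'', reassoc_of% hy, this]
    have he : Epi (HomologicalComplex.homologyMap φ 1) := by
      rw [HomologicalComplex.epi_homologyMap_iff_up_to_refinements φ 2 1 0 (by simp) (by simp)]
      intro T y hy
      -- For a cycle y of D₁, lift its `κ`-value along `c` to x. The difference of y and the image
      -- of x is killed by both components of the map to D₀ ⊕ K, so it is a boundary.
      obtain ⟨T', π, _, x, hx⟩ := surjective_up_to_refinements_of_epi c (y ≫ κ)
      obtain ⟨T'', π', _, z, hz⟩ := hD₁.exact_up_to_refinements (π ≫ y - x ≫ f 1) (by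
        apply biprod.hom_ext
        · simp [hy, h₁']
        · simp [h₁'', hx])
      refine ⟨T'', π' ≫ π, inferInstance, π' ≫ x, hC₀.eq_of_tgt _ _, z, ?_⟩
      change _ = (π' ≫ x) ≫ f 1 + _
      rw [← hz]
      simp
    rw [quasiIsoAt_iff_isIso_homologyMap]
    exact isIso_of_mono_of_epi _
  | n + 2 =>
    rw [quasiIsoAt_iff_exactAt]
    · exact exactAt _ _ (hD n)
    · exact exactAt _ _ (hC n)

/-- An additive functor sends a quasi-isomorphism between complexes of projectives to complexes
with isomorphic homology. -/
lemma nonempty_homology_map_iso {B : Type*} [Category* B] [Abelian B] (F : A ⥤ B) [F.Additive]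
    [∀ n, Projective (C.X n)] [∀ n, Projective (D.X n)] (φ : C ⟶ D) [QuasiIso φ] (n : ℕ) :
    Nonempty (((F.mapHomologicalComplex _).obj C).homology n ≅
      ((F.mapHomologicalComplex _).obj D).homology n) := by
  -- Between these complexes of projectives a quasi-isomorphism is a homotopy equivalence, which
  -- additive functors preserve without being exact.
  obtain ⟨e, -⟩ := (quasiIso_iff_of_projective φ).1 ‹_›
  exact ⟨(F.mapHomotopyEquiv e).toHomologyIso n⟩

end ChainComplex

end

/-! ### Permutation modules of free actions -/

section FreeAction

variable (Γ X : Type) [Group Γ] [MulAction Γ X]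

/-- The permutation module of a free action is a free representation. -/
lemma Representation.nonempty_ofMulAction_equiv_free (k : Type) [CommRing k]
    (hX : ∀ (g : Γ) (x : X), g • x = x → g = 1) :
    Nonempty ((Representation.free k Γ (MulAction.orbitRel.Quotient Γ X)).Equiv
      (Representation.ofMulAction k Γ X)) := by
  -- With a representative chosen in each orbit, freeness makes the element `t x` carrying the
  -- representative to x unique; x ↦ (orbit of x, `t x`) gives the inverse map.
  let q : X → MulAction.orbitRel.Quotient Γ X := Quotient.mk _
  have hq : ∀ x, ∃ g : Γ, g • (q x).out = x := fun x =>
    MulAction.mem_orbit_iff.1 (MulAction.orbitRel_apply.1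
      (Setoid.symm' _ (Quotient.exact (Quotient.out_eq (q x)))))
  choose t ht using hq
  have hfree : ∀ (g h : Γ) (x : X), g • x = h • x → g = h := fun g h x hgh => by
    have := hX (h⁻¹ * g) x (by rw [mul_smul, hgh, inv_smul_smul])
    exact (inv_mul_eq_one.1 this).symm
  have hqg : ∀ (g : Γ) (o : MulAction.orbitRel.Quotient Γ X), q (g • o.out) = o := fun g o => by
    rw [← Quotient.out_eq o]
    exact Quotient.sound (MulAction.orbitRel_apply.2 ⟨g, by rw [Quotient.out_eq]⟩)
  have htg : ∀ (g : Γ) (o : MulAction.orbitRel.Quotient Γ X), t (g • o.out) = g := fun g o =>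
    hfree _ _ o.out (by simpa only [hqg] using ht (g • o.out))
  let f := Representation.freeLift (Representation.ofMulAction k Γ X)
    fun o : MulAction.orbitRel.Quotient Γ X => MonoidAlgebra.single o.out 1
  let f' : MonoidAlgebra k X →ₗ[k]
      (MulAction.orbitRel.Quotient Γ X →₀ MonoidAlgebra k Γ) :=
    Finsupp.linearCombination k (fun x => Finsupp.single (q x) (MonoidAlgebra.single (t x) 1)) ∘ₗ
      (MonoidAlgebra.coeffLinearEquiv k).toLinearMap
  have hf' : ∀ x, f' (MonoidAlgebra.single x 1) =
      Finsupp.single (q x) (MonoidAlgebra.single (t x) 1) := fun x => by simp [f']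
  have h₁ : f' ∘ₗ f.toLinearMap = LinearMap.id := by
    refine Finsupp.lhom_ext' fun o => MonoidAlgebra.lhom_ext' fun g => LinearMap.ext_ring ?_
    change f' (f (Finsupp.single o (MonoidAlgebra.single g 1))) = _
    rw [Representation.freeLift_single_single, one_smul, Representation.ofMulAction_single, hf',
      hqg, htg]
    rfl
  have h₂ : f.toLinearMap ∘ₗ f' = LinearMap.id := by
    refine MonoidAlgebra.lhom_ext' fun x => LinearMap.ext_ring ?_
    change f (f' (MonoidAlgebra.single x 1)) = _
    rw [hf', Representation.freeLift_single_single, one_smul, Representation.ofMulAction_single,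
      ht]
    rfl
  exact ⟨f.ofBijective ⟨Function.LeftInverse.injective (g := f') fun x => LinearMap.congr_fun h₁ x,
    Function.RightInverse.surjective (g := f') fun x => LinearMap.congr_fun h₂ x⟩⟩

variable {Γ X}

lemma Rep.free_asModule_ofMulAction (hX : ∀ (g : Γ) (x : X), g • x = x → g = 1) :
    Module.Free (MonoidAlgebra ℤ Γ) (Rep.ofMulAction ℤ Γ X).ρ.asModule := by
  obtain ⟨e⟩ := Representation.nonempty_ofMulAction_equiv_free Γ X ℤ hX
  have := Representation.free_asModule_free ℤ Γ (MulAction.orbitRel.Quotient Γ X)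
  have : Module.Free (MonoidAlgebra ℤ Γ) (Rep.toModuleMonoidAlgebra.obj
    (Rep.of (Representation.free ℤ Γ (MulAction.orbitRel.Quotient Γ X)))) := this
  exact Module.Free.of_equiv ((Rep.toModuleMonoidAlgebra.mapIso (Rep.mkIso e)).toLinearEquiv)

lemma Rep.projective_ofMulAction (hX : ∀ (g : Γ) (x : X), g • x = x → g = 1) :
    Projective (Rep.ofMulAction ℤ Γ X) := by
  obtain ⟨e⟩ := Representation.nonempty_ofMulAction_equiv_free Γ X ℤ hX
  exact Projective.of_iso (Rep.mkIso e) inferInstance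

end FreeAction

noncomputable section

namespace TruncatedComplex

/-! ### Counter-diagonal elements and cosets of `P` -/

@[simp]
lemma coe_unipotent (x : ℂ) : (unipotent x : Matrix (Fin 2) (Fin 2) ℂ) = !![1, x; 0, 1] := rfl

@[simp]
lemma coe_counterDiagonal (a : ℂ) (ha : a ≠ 0) :
    (counterDiagonal a ha : Matrix (Fin 2) (Fin 2) ℂ) = !![0, -a⁻¹; a, 0] := rfl

/-- The centre of SL(2, ℂ) consists of scalar matrices, so entries can be compared in PSL(2, ℂ) up
to a common factor; vanishing of an entry is well defined. -/
lemma exists_smul_eq_of_coe_eq {A B : SL(2, ℂ)} (h : (A : G) = B) :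
    ∃ r : ℂ, ∀ i j, B.1 i j = A.1 i j * r := by
  obtain ⟨r, -, hr⟩ := Matrix.SpecialLinearGroup.mem_center_iff.1 (QuotientGroup.eq.1 h)
  refine ⟨r, fun i j => ?_⟩
  have : B.1 = A.1 * Matrix.scalar (Fin 2) r := by
    rw [hr, ← Matrix.SpecialLinearGroup.coe_mul, mul_inv_cancel_left]
  rw [this]
  simp

lemma IsCounterDiagonal.inv {w : G} (h : IsCounterDiagonal w) : IsCounterDiagonal w⁻¹ := by
  obtain ⟨a, ha, rfl⟩ := h
  refine ⟨-a, neg_ne_zero.2 ha, inv_eq_of_mul_eq_one_right ?_⟩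
  rw [← QuotientGroup.mk_mul, ← QuotientGroup.mk_one]
  congr 1
  apply Subtype.ext
  rw [Matrix.SpecialLinearGroup.coe_mul]
  ext i j
  fin_cases i <;> fin_cases j <;> simp [counterDiagonal, ha]

/-- With upper right entries x of p and y of q, the diagonal entries of pwq are xa and ay; they
vanish only for x = y = 0. -/
lemma IsCounterDiagonal.eq_one {w p q : G} (h : IsCounterDiagonal w) (hp : p ∈ P) (hq : q ∈ P)
    (h' : IsCounterDiagonal (p * w * q)) : p = 1 ∧ q = 1 := by
  obtain ⟨a, ha, rfl⟩ := h
  obtain ⟨x, rfl⟩ := hp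
  obtain ⟨y, rfl⟩ := hq
  obtain ⟨b, hb, h'⟩ := h'
  rw [← QuotientGroup.mk_mul, ← QuotientGroup.mk_mul] at h'
  obtain ⟨r, hr⟩ := exists_smul_eq_of_coe_eq h'.symm
  have h₀ := hr 0 0
  have h₁ := hr 1 1
  simp only [Matrix.SpecialLinearGroup.coe_mul, coe_unipotent, coe_counterDiagonal] at h₀ h₁
  simp [ha] at h₀ h₁
  rw [h₀, h₁, unipotent_zero]
  exact ⟨rfl, rfl⟩

/-- A product of two counter-diagonal matrices is diagonal, so the whole product is upper
triangular, while a counter-diagonal matrix has nonzero lower left entry. -/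
lemma IsCounterDiagonal.not_mul {w w' p q : G} (h : IsCounterDiagonal w)
    (h' : IsCounterDiagonal w') (hp : p ∈ P) (hq : q ∈ P) :
    ¬ IsCounterDiagonal (p * (w * w') * q) := by
  obtain ⟨a, ha, rfl⟩ := h
  obtain ⟨a', ha', rfl⟩ := h'
  obtain ⟨x, rfl⟩ := hp
  obtain ⟨y, rfl⟩ := hq
  rintro ⟨b, hb, h⟩
  rw [← QuotientGroup.mk_mul, ← QuotientGroup.mk_mul, ← QuotientGroup.mk_mul] at h
  obtain ⟨r, hr⟩ := exists_smul_eq_of_coe_eq h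
  have h₀ := hr 1 0
  simp only [Matrix.SpecialLinearGroup.coe_mul, coe_unipotent, coe_counterDiagonal] at h₀
  simp [hb] at h₀

/-- One row and one column operation with the pivot in the lower left corner clear the diagonal;
determinant 1 then fixes the upper right entry. -/
lemma exists_isCounterDiagonal_mul {M : SL(2, ℂ)} (hM : M.1 1 0 ≠ 0) :
    ∃ p ∈ P, ∃ q ∈ P, IsCounterDiagonal (p * (M : G) * q) := by
  have hdet : M.1 0 0 * M.1 1 1 - M.1 0 1 * M.1 1 0 = 1 := by
    rw [← Matrix.det_fin_two]
    exact M.2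
  refine ⟨_, ⟨-(M.1 0 0) / M.1 1 0, rfl⟩, _, ⟨-(M.1 1 1) / M.1 1 0, rfl⟩, M.1 1 0, hM, ?_⟩
  rw [← QuotientGroup.mk_mul, ← QuotientGroup.mk_mul]
  congr 1
  apply Subtype.ext
  rw [Matrix.SpecialLinearGroup.coe_mul, Matrix.SpecialLinearGroup.coe_mul, coe_unipotent,
    coe_unipotent, coe_counterDiagonal, Matrix.eta_fin_two M.1]
  ext i j
  fin_cases i <;> fin_cases j <;> simp <;> field_simp
  · ring
  · linear_combination -hdet
  · ring

/-- Two cosets of `P` are in general position if they contain elements `a`, `b` with `a⁻¹ * b`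
counter-diagonal. -/
def Generic (A B : G ⧸ P) : Prop :=
  ∃ a b : G, (a : G ⧸ P) = A ∧ (b : G ⧸ P) = B ∧ IsCounterDiagonal (a⁻¹ * b)

lemma Generic.symm {A B : G ⧸ P} : Generic A B → Generic B A := fun ⟨a, b, ha, hb, h⟩ =>
  ⟨b, a, hb, ha, by simpa using h.inv⟩

lemma eq_and_eq_of_isCounterDiagonal {a b a' b' : G} (ha : (a : G ⧸ P) = a')
    (hb : (b : G ⧸ P) = b') (h : IsCounterDiagonal (a⁻¹ * b))
    (h' : IsCounterDiagonal (a'⁻¹ * b')) : a = a' ∧ b = b' := by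
  obtain ⟨hp, hq⟩ := h.eq_one (P.inv_mem (QuotientGroup.eq.1 ha)) (QuotientGroup.eq.1 hb)
    (by simpa [mul_assoc] using h')
  exact ⟨(inv_mul_eq_one.1 (inv_eq_one.1 hp)), inv_mul_eq_one.1 hq⟩

open Classical in
/-- For cosets `A`, `B` in general position, the element of `A` such that `(edgeLabel A B)⁻¹ *
edgeLabel B A` is counter-diagonal. -/
def edgeLabel (A B : G ⧸ P) : G := if h : Generic A B then h.choose else 1

lemma edgeLabel_eq {a b : G} (h : IsCounterDiagonal (a⁻¹ * b)) :
    edgeLabel (a : G ⧸ P) (b : G ⧸ P) = a := by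
  have hab : Generic (a : G ⧸ P) (b : G ⧸ P) := ⟨a, b, rfl, rfl, h⟩
  obtain ⟨b', ha', hb', h'⟩ := hab.choose_spec
  rw [edgeLabel, dif_pos hab]
  exact (eq_and_eq_of_isCounterDiagonal ha' hb' h' h).1

lemma Generic.coe_edgeLabel {A B : G ⧸ P} (h : Generic A B) :
    (edgeLabel A B : G ⧸ P) = A := by
  obtain ⟨a, b, rfl, rfl, h⟩ := h
  rw [edgeLabel_eq h]

lemma Generic.isCounterDiagonal {A B : G ⧸ P} (h : Generic A B) :
    IsCounterDiagonal ((edgeLabel A B)⁻¹ * edgeLabel B A) := by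
  obtain ⟨a, b, rfl, rfl, h⟩ := h
  rw [edgeLabel_eq h, edgeLabel_eq (by simpa using h.inv)]
  exact h

/-- If the two labels agreed in a, then b⁻¹a and a⁻¹c would both be counter-diagonal, so B and C
would be related by a diagonal element and could not be in general position. -/
lemma Generic.edgeLabel_ne {A B C : G ⧸ P} (hAB : Generic A B) (hAC : Generic A C)
    (hBC : Generic B C) : edgeLabel A B ≠ edgeLabel A C := by
  obtain ⟨a, b, rfl, rfl, h⟩ := hAB
  obtain ⟨a', c, ha, rfl, h'⟩ := hAC
  obtain ⟨b', c', hb, hc, h''⟩ := hBC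
  rw [← ha, edgeLabel_eq h', ha, edgeLabel_eq h]
  rintro rfl
  refine h.inv.not_mul h' (P.inv_mem (QuotientGroup.eq.1 hb.symm)) (QuotientGroup.eq.1 hc.symm) ?_
  simpa [mul_assoc] using h''

/-- For finitely many cosets there is a coset in general position to all of them. -/
lemma exists_generic (S : Finset (G ⧸ P)) : ∃ U : G ⧸ P, ∀ A ∈ S, Generic U A := by
  have hrep : ∀ A : G ⧸ P, ∃ M : SL(2, ℂ), ((M : G) : G ⧸ P) = A := fun A => by
    obtain ⟨g, rfl⟩ := QuotientGroup.mk_surjective A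
    obtain ⟨M, rfl⟩ := QuotientGroup.mk_surjective g
    exact ⟨M, rfl⟩
  choose M hM using hrep
  -- The ratio of the first column is the point M·∞ of the projective line, and `U` below sends ∞ to
  -- z. Avoiding these finitely many points makes the lower left entry of U⁻¹M nonzero. For M·∞ = ∞
  -- the ratio is 0 by convention, which merely excludes one further value of z.
  obtain ⟨z, hz⟩ := Infinite.exists_notMem_finset (S.image fun A => (M A).1 0 0 / (M A).1 1 0)
  let U : SL(2, ℂ) := ⟨!![z, -1; 1, 0], by simp⟩
  refine ⟨(U : G), fun A hA => ?_⟩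
  have hz' : ((M A).1 0 0) / ((M A).1 1 0) ≠ z := fun h =>
    hz (h ▸ Finset.mem_image_of_mem _ hA)
  have hdet : (M A).1 0 0 * (M A).1 1 1 - (M A).1 0 1 * (M A).1 1 0 = 1 := by
    rw [← Matrix.det_fin_two]
    exact (M A).2
  have hne : (U⁻¹ * M A).1 1 0 ≠ 0 := by
    rw [Matrix.SpecialLinearGroup.coe_mul, Matrix.SpecialLinearGroup.coe_inv]
    simp only [U, Matrix.adjugate_fin_two_of, Matrix.mul_apply, Fin.sum_univ_two]
    intro h
    simp at h
    rcases eq_or_ne ((M A).1 1 0) 0 with h0 | h0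
    · simp only [h0] at h hdet
      simp at h
      simp [h] at hdet
    · refine hz' ?_
      rw [div_eq_iff h0]
      linear_combination -h
  obtain ⟨p, hp, q, hq, h⟩ := exists_isCounterDiagonal_mul hne
  refine ⟨U * p⁻¹, M A * q, ?_, ?_, ?_⟩
  · exact QuotientGroup.mk_mul_of_mem _ (P.inv_mem hp)
  · rw [QuotientGroup.mk_mul_of_mem _ hq, hM]
  · rw [QuotientGroup.mk_mul, QuotientGroup.mk_inv] at h
    simpa [mul_assoc] using h

end TruncatedComplex

end

noncomputable section

namespace TruncatedComplex

/-! ### Generators as tuples of cosets in pairwise general position; cones -/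

namespace Generator

variable {n : ℕ}

lemma exists_ne (α : Generator n) (i : Fin (n + 1)) : ∃ j, i ≠ j := by
  have : Nontrivial (Fin (n + 1)) := Fin.nontrivial_iff_two_le.2 (Nat.succ_le_succ α.pos)
  obtain ⟨j, hj⟩ := _root_.exists_ne i
  exact ⟨j, hj.symm⟩

/-- The coset containing the labels near the `i`-th vertex. -/
def vertex (α : Generator n) (i : Fin (n + 1)) : G ⧸ P :=
  (α.label i (α.exists_ne i).choose (α.exists_ne i).choose_spec : G ⧸ P)

lemma coe_label (α : Generator n) {i j : Fin (n + 1)} (h : i ≠ j) :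
    (α.label i j h : G ⧸ P) = α.vertex i :=
  α.coset _ _ _ _ _

lemma generic_vertex (α : Generator n) {i j : Fin (n + 1)} (h : i ≠ j) :
    Generic (α.vertex i) (α.vertex j) :=
  ⟨_, _, α.coe_label h, α.coe_label h.symm, α.counter i j h⟩

lemma label_eq (α : Generator n) {i j : Fin (n + 1)} (h : i ≠ j) :
    α.label i j h = edgeLabel (α.vertex i) (α.vertex j) := by
  rw [← α.coe_label h, ← α.coe_label h.symm, edgeLabel_eq (α.counter i j h)]

/-- Uniqueness of the counter-diagonal pair recovers every label from the two cosets involved, so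
identities between faces and cones can be checked on vertices. -/
lemma ext_vertex {α β : Generator n} (h : ∀ i, α.vertex i = β.vertex i) : α = β := by
  apply Generator.ext
  funext i j hij
  rw [label_eq, label_eq, h, h]

/-- The generator with prescribed cosets at the vertices. -/
@[simps label]
def ofVertices (hn : 1 ≤ n) (v : Fin (n + 1) → G ⧸ P)
    (hv : ∀ i j, i ≠ j → Generic (v i) (v j)) : Generator n where
  label i j _ := edgeLabel (v i) (v j)
  pos := hn
  coset i j k hj hk := by rw [(hv i j hj).coe_edgeLabel, (hv i k hk).coe_edgeLabel]
  distinct i j k hj hk hjk := (hv i j hj).edgeLabel_ne (hv i k hk) (hv j k hjk)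
  counter i j h := (hv i j h).isCounterDiagonal

@[simp]
lemma vertex_ofVertices (hn : 1 ≤ n) (v : Fin (n + 1) → G ⧸ P)
    (hv : ∀ i j, i ≠ j → Generic (v i) (v j)) (i : Fin (n + 1)) :
    (ofVertices hn v hv).vertex i = v i := by
  obtain ⟨j, hj⟩ := (ofVertices hn v hv).exists_ne i
  rw [← coe_label _ hj]
  exact (hv i j hj).coe_edgeLabel

@[simp]
lemma vertex_face (k : Fin (n + 3)) (α : Generator (n + 2)) (i : Fin (n + 2)) :
    (face k α).vertex i = α.vertex (k.succAbove i) := by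
  obtain ⟨j, hj⟩ := (face k α).exists_ne i
  rw [← coe_label _ hj, ← coe_label _ (k.succAbove_right_injective.ne hj)]
  rfl

lemma cosetOfEdge_eq (α : Generator 1) : α.cosetOfEdge = α.vertex := by
  funext i
  fin_cases i
  · exact α.coe_label _
  · exact α.coe_label _

lemma smul_eq_self {g : G} {α : Generator n} (h : g • α = α) : g = 1 := by
  obtain ⟨j, hj⟩ := α.exists_ne 0
  have := congrArg (fun β => label β 0 j hj) h
  simpa using this

variable {U : G ⧸ P}

/-- The cone over a generator with a new zeroth vertex. -/
def cone (α : Generator n) (h : ∀ i, Generic U (α.vertex i)) : Generator (n + 1) :=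
  ofVertices (Nat.succ_le_succ n.zero_le) (Fin.cons U α.vertex) fun i j hij => by
    cases i using Fin.cases with
    | zero =>
      cases j using Fin.cases with
      | zero => exact absurd rfl hij
      | succ j => simpa using h j
    | succ i =>
      cases j using Fin.cases with
      | zero => simpa using (h i).symm
      | succ j => simpa using α.generic_vertex (fun h => hij (congrArg _ h))

@[simp]
lemma vertex_cone (α : Generator n) (h : ∀ i, Generic U (α.vertex i)) :
    (α.cone h).vertex = Fin.cons U α.vertex :=
  funext (vertex_ofVertices _ _ _)

lemma face_zero_cone (α : Generator (n + 1)) (h : ∀ i, Generic U (α.vertex i)) :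
    face 0 (α.cone h) = α :=
  ext_vertex fun i => by simp

lemma face_succ_cone (α : Generator (n + 2)) (h : ∀ i, Generic U (α.vertex i))
    (k : Fin (n + 3)) :
    face k.succ (α.cone h) = (face k α).cone fun i => by simpa using h _ :=
  ext_vertex fun i => by
    cases i using Fin.cases with
    | zero => simp
    | succ i => simp

/-- The edge between two cosets in general position. -/
def edge {A B : G ⧸ P} (h : Generic A B) : Generator 1 :=
  ofVertices le_rfl ![A, B] fun i j hij => by
    fin_cases i <;> fin_cases j
    · exact absurd rfl hij
    · exact h
    · exact h.symm
    · exact absurd rfl hij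

/-- In this degree the faces of the base are single vertices, which are not generators, so the cone
on such a face has to be replaced by an edge starting at U. -/
lemma face_succ_cone_one (α : Generator 1) (h : ∀ i, Generic U (α.vertex i)) (k : Fin 2) :
    face k.succ (α.cone h) = edge (h (k.succAbove 0)) :=
  ext_vertex fun i => by
    fin_cases i
    · simp [edge]
    · rw [vertex_face, vertex_cone, edge, vertex_ofVertices]
      change Fin.cons (α := fun _ => G ⧸ P) U α.vertex (k.succ.succAbove (Fin.succ 0)) = _
      rw [Fin.succ_succAbove_succ, Fin.cons_succ]
      rfl

end Generator

/-! ### Exactness of the complex of truncated simplices -/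

open MonoidAlgebra (single)

lemma eq_sum_single {X : Type} (x : MonoidAlgebra ℤ X) :
    x = ∑ a ∈ x.coeff.support, x.coeff a • single a 1 := by
  conv_lhs => rw [← x.sum_coeff_single]
  simp [Finsupp.sum]

lemma boundary_single {n : ℕ} (α : Generator (n + 2)) :
    (boundary (n + 1)).hom (single α 1) =
      ∑ k : Fin (n + 3), (-1 : ℤ) ^ (k : ℕ) • single (α.face k) 1 := by
  simp only [boundary, Rep.sum_hom, Rep.zsmul_hom, Representation.IntertwiningMap.sum_apply,
    Representation.IntertwiningMap.smul_apply]
  exact Finset.sum_congr rfl fun k _ => congrArg _ (mapRep_single _ _ _ _)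

open Classical in
/-- Two linear maps on a permutation module which agree on all elements satisfying a property. -/
lemma linearMap_eq_of_forall_mem_support {X M : Type} [AddCommGroup M]
    {f g : MonoidAlgebra ℤ X →ₗ[ℤ] M} (x : MonoidAlgebra ℤ X)
    (h : ∀ a ∈ x.coeff.support, f (single a 1) = g (single a 1)) : f x = g x := by
  rw [eq_sum_single x, map_sum, map_sum]
  exact Finset.sum_congr rfl fun a ha => by rw [map_smul, map_smul, h a ha]

open Classical in
/-- The linear extension of a partially defined map. -/
def partialLift {X Y : Type} (p : X → Prop) (f : ∀ x, p x → Y) :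
    MonoidAlgebra ℤ X →ₗ[ℤ] MonoidAlgebra ℤ Y :=
  -- The default value 0 is never met when coning off a chain with generic U; for
  -- `InvariantSubcomplex.collapse` it is what kills the subcomplex.
  Finsupp.linearCombination ℤ (fun x => if h : p x then single (f x h) (1 : ℤ) else 0) ∘ₗ
    (MonoidAlgebra.coeffLinearEquiv ℤ).toLinearMap

lemma partialLift_single {X Y : Type} {p : X → Prop} (f : ∀ x, p x → Y) {x : X} (h : p x) :
    partialLift p f (single x 1) = single (f x h) 1 := by
  simp [partialLift, h]

open Classical in
lemma exists_generic_vertex {n : ℕ} (x : MonoidAlgebra ℤ (Generator n)) :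
    ∃ U : G ⧸ P, ∀ α ∈ x.coeff.support, ∀ i, Generic U (α.vertex i) := by
  obtain ⟨U, hU⟩ := exists_generic
    (x.coeff.support.biUnion fun α => Finset.univ.image α.vertex)
  exact ⟨U, fun α hα i => hU _ (Finset.mem_biUnion.2
    ⟨α, hα, Finset.mem_image_of_mem _ (Finset.mem_univ i)⟩)⟩

/-- The cone operator with vertex `U`. -/
def coneMap (U : G ⧸ P) (n : ℕ) :
    MonoidAlgebra ℤ (Generator n) →ₗ[ℤ] MonoidAlgebra ℤ (Generator (n + 1)) :=
  partialLift (fun α => ∀ i, Generic U (α.vertex i)) fun α h => α.cone h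

/-- Cone homotopy: the zeroth face of a cone is its base and the other faces are cones on faces, so
x = ∂(cone x) + cone(∂x). The vertex U depends on the support of x; no global contraction is
claimed. -/
lemma exists_boundary_eq {n : ℕ} (x : chains (n + 2)) (hx : (boundary (n + 1)).hom x = 0) :
    ∃ y, (boundary (n + 2)).hom y = x := by
  obtain ⟨U, hU⟩ := exists_generic_vertex x
  have key : (LinearMap.id : MonoidAlgebra ℤ (Generator (n + 2)) →ₗ[ℤ] _) x =
      ((boundary (n + 2)).hom.toLinearMap ∘ₗ coneMap U (n + 2) +
        coneMap U (n + 1) ∘ₗ (boundary (n + 1)).hom.toLinearMap) x := by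
    refine linearMap_eq_of_forall_mem_support x fun α hα => ?_
    have h := hU α hα
    change _ = (boundary (n + 2)).hom (coneMap U (n + 2) (single α 1)) +
      coneMap U (n + 1) ((boundary (n + 1)).hom (single α 1))
    rw [coneMap, partialLift_single _ h, boundary_single, boundary_single, Fin.sum_univ_succ,
      map_sum, Generator.face_zero_cone]
    have : ∀ k : Fin (n + 3), coneMap U (n + 1) ((-1 : ℤ) ^ (k : ℕ) • single (α.face k) 1) =
        (-1 : ℤ) ^ (k : ℕ) • single (Generator.face k.succ (α.cone h)) 1 := fun k => by
      rw [map_smul, coneMap, partialLift_single _ (fun i => by simpa using h _),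
        Generator.face_succ_cone]
    rw [Finset.sum_congr rfl fun k _ => this k]
    simp [pow_succ]
  refine ⟨coneMap U (n + 2) x, ?_⟩
  have h0 : coneMap U (n + 1) ((boundary (n + 1)).hom x) = 0 := by rw [hx]; exact map_zero _
  refine (key.trans ?_).symm
  change (boundary (n + 2)).hom (coneMap U (n + 2) x) +
    coneMap U (n + 1) ((boundary (n + 1)).hom x) = _
  rw [h0, add_zero]

/-- The chain of edges from a vertex `U` to given cosets. -/
def edgeTo (U : G ⧸ P) : MonoidAlgebra ℤ (G ⧸ P) →ₗ[ℤ] MonoidAlgebra ℤ (Generator 1) :=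
  partialLift (fun A => Generic U A) fun _ h => Generator.edge h

/-- The same homotopy at the bottom, where joining a coset to U by an edge replaces the cone on ∂x.
-/
lemma exists_boundary_eq_one (x : chains 1) (hx : edgeMap.hom x = 0) :
    ∃ y, (boundary 1).hom y = x := by
  obtain ⟨U, hU⟩ := exists_generic_vertex x
  have key : (LinearMap.id : MonoidAlgebra ℤ (Generator 1) →ₗ[ℤ] _) x =
      ((boundary 1).hom.toLinearMap ∘ₗ coneMap U 1 +
        edgeTo U ∘ₗ edgeMap.hom.toLinearMap) x := by
    refine linearMap_eq_of_forall_mem_support x fun α hα => ?_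
    have h := hU α hα
    change _ = (boundary 1).hom (coneMap U 1 (single α 1)) +
      edgeTo U (edgeMap.hom (single α 1))
    rw [coneMap, partialLift_single _ h, boundary_single, Fin.sum_univ_succ, edgeMap_single,
      Generator.face_zero_cone, map_sub, Generator.cosetOfEdge_eq, edgeTo,
      partialLift_single _ (h 1), partialLift_single _ (h 0)]
    simp only [Generator.face_succ_cone_one, Fin.sum_univ_two]
    have h₀ : (0 : Fin 2).succAbove 0 = 1 := rfl
    have h₁ : (1 : Fin 2).succAbove 0 = 0 := rfl
    simp only [h₀, h₁, Fin.val_zero, Fin.val_succ, Fin.val_one, pow_zero, one_smul, zero_add,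
      pow_one, neg_smul, LinearMap.id_apply]
    norm_num
    abel
  refine ⟨coneMap U 1 x, ?_⟩
  have h0 : edgeTo U (edgeMap.hom x) = 0 := by rw [hx]; exact map_zero _
  refine (key.trans ?_).symm
  change (boundary 1).hom (coneMap U 1 x) + edgeTo U (edgeMap.hom x) = _
  rw [h0, add_zero]

/-- Replacing each coset A by the edge from U to A gives x up to the total coefficient times U. -/
lemma exists_edgeMap_eq (x : cosetChains) (hx : augmentation.hom x = 0) :
    ∃ y, edgeMap.hom y = x := by
  obtain ⟨U, hU⟩ := exists_generic (MonoidAlgebra.coeff x).support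
  let s : ℤ →ₗ[ℤ] MonoidAlgebra ℤ (G ⧸ P) := LinearMap.toSpanSingleton ℤ _ (single U 1)
  have key : (LinearMap.id : MonoidAlgebra ℤ (G ⧸ P) →ₗ[ℤ] _) x =
      (edgeMap.hom.toLinearMap ∘ₗ edgeTo U + s ∘ₗ augmentation.hom.toLinearMap) x := by
    refine linearMap_eq_of_forall_mem_support x fun A hA => ?_
    have h := hU A hA
    change _ = edgeMap.hom (edgeTo U (single A 1)) + s (augmentation.hom (single A 1))
    rw [edgeTo, partialLift_single _ h, edgeMap_single, augmentation_single,
      Generator.cosetOfEdge_eq]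
    simp [s, Generator.edge]
  refine ⟨edgeTo U x, ?_⟩
  have h0 : s (augmentation.hom x) = 0 := by rw [hx]; exact map_zero _
  refine (key.trans ?_).symm
  change edgeMap.hom (edgeTo U x) + s (augmentation.hom x) = _
  rw [h0, add_zero]

lemma boundary_one_single (α : Generator 2) : (boundary 1).hom (single α 1) =
    single (Generator.face 0 α : Generator 1) 1 - single (Generator.face 1 α : Generator 1) 1 +
      single (Generator.face 2 α : Generator 1) 1 :=
  (boundary_single α).trans (by rw [Fin.sum_univ_three]; simp [sub_eq_add_neg])

lemma edgeMap_boundary (x : chains 2) : edgeMap.hom ((boundary 1).hom x) = 0 := by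
  have h : edgeMap.hom.toLinearMap ∘ₗ (boundary 1).hom.toLinearMap = 0 := by
    refine MonoidAlgebra.lhom_ext' fun α => LinearMap.ext_ring ?_
    change edgeMap.hom ((boundary 1).hom (single α 1)) = 0
    rw [boundary_one_single, map_add, map_sub, edgeMap_single, edgeMap_single, edgeMap_single]
    simp only [Generator.cosetOfEdge_eq, Generator.vertex_face]
    have h₀ : (0 : Fin 3).succAbove 0 = 1 := rfl
    have h₁ : (0 : Fin 3).succAbove 1 = 2 := rfl
    have h₂ : (1 : Fin 3).succAbove 0 = 0 := rfl
    have h₃ : (1 : Fin 3).succAbove 1 = 2 := rfl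
    have h₄ : (2 : Fin 3).succAbove 0 = 0 := rfl
    have h₅ : (2 : Fin 3).succAbove 1 = 1 := rfl
    simp [h₀, h₁, h₂, h₃, h₄, h₅]
  exact LinearMap.congr_fun h x

lemma Cbar_d (n : ℕ) : Cbar.d (n + 1) n = boundary n := ChainComplex.of_d ..

lemma free_Cbar (n : ℕ) : Module.Free (MonoidAlgebra ℤ G) (Cbar.X n).ρ.asModule :=
  Rep.free_asModule_ofMulAction fun _ _ => Generator.smul_eq_self

instance projective_Cbar (n : ℕ) : Projective (Cbar.X n) :=
  Rep.projective_ofMulAction fun _ _ => Generator.smul_eq_self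

lemma surjective_toK : Function.Surjective toK.hom := fun x => by
  obtain ⟨y, hy⟩ := exists_edgeMap_eq x.1 x.2
  exact ⟨y, Subtype.ext hy⟩

lemma exact_Cbar_toK : Function.Exact (Cbar.d 2 1).hom toK.hom := fun x => by
  rw [Cbar_d]
  constructor
  · intro h
    exact exists_boundary_eq_one x (congrArg Subtype.val h)
  · rintro ⟨y, rfl⟩
    exact Subtype.ext (edgeMap_boundary y)

lemma exact_Cbar (n : ℕ) :
    Function.Exact (Cbar.d (n + 3) (n + 2)).hom (Cbar.d (n + 2) (n + 1)).hom := fun x => by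
  constructor
  · rw [Cbar_d, Cbar_d]
    exact exists_boundary_eq x
  · rintro ⟨y, rfl⟩
    exact congr($(Cbar.d_comp_d (n + 3) (n + 2) (n + 1)).hom y)

end TruncatedComplex

end

noncomputable section

open Opposite Simplicial

/-! ### Points and maps of geometric realizations -/

namespace GeometricRealization

variable {X Y : SSet.{0}}

/-- The characteristic map of a simplex of a simplicial set. -/
def simplexMap {n : SimplexCategory} (x : X.obj (op n)) :
    C(stdSimplex ℝ (Fin (n.len + 1)), SSet.toTop.obj X) :=
  TopCat.toSSetObjEquiv _ (op n) ((sSetTopAdj.unit.app X).app (op n) x)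

lemma simplexMap_map {n m : SimplexCategory} (f : n ⟶ m) (x : X.obj (op m))
    (t : stdSimplex ℝ (Fin (n.len + 1))) :
    simplexMap (X.map f.op x) t = simplexMap x (stdSimplex.map f t) := by
  have h := congr($((sSetTopAdj.unit.app X).naturality f.op) x)
  have h' := TopCat.toSSetObjEquiv_naturality_apply f ((sSetTopAdj.unit.app X).app (op m) x) t
  exact congr(TopCat.toSSetObjEquiv _ (op n) $h t).trans h'

lemma toTop_map_simplexMap (φ : X ⟶ Y) {n : SimplexCategory} (x : X.obj (op n))
    (t : stdSimplex ℝ (Fin (n.len + 1))) :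
    SSet.toTop.map φ (simplexMap x t) = simplexMap (φ.app (op n) x) t := by
  have h := congr($(congr_app (sSetTopAdj.unit.naturality φ) (op n)) x)
  exact congr(TopCat.toSSetObjEquiv _ (op n) $h t).symm

/-- The continuous map out of a geometric realization determined by a compatible family of
continuous maps on simplices. -/
def toTopDesc {Z : TopCat.{0}}
    (f : ∀ n : SimplexCategory, X.obj (op n) → C(stdSimplex ℝ (Fin (n.len + 1)), Z))
    (hf : ∀ (n m : SimplexCategory) (θ : n ⟶ m) (x : X.obj (op m))
      (t : stdSimplex ℝ (Fin (n.len + 1))),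
      f n (X.map θ.op x) t = f m x (stdSimplex.map θ t)) :
    SSet.toTop.obj X ⟶ Z :=
  (sSetTopAdj.homEquiv X Z).symm
    { app := fun n => ↾fun x => (TopCat.toSSetObjEquiv Z n).symm (f n.unop x)
      naturality := fun n m θ => by
        ext x
        refine (TopCat.toSSetObjEquiv Z m).injective (ContinuousMap.ext fun t => ?_)
        exact (congr($((TopCat.toSSetObjEquiv Z m).apply_symm_apply
          (f m.unop (X.map θ x))) t)).trans (hf _ _ θ.unop x t) }

lemma toTopDesc_simplexMap {Z : TopCat.{0}}
    (f : ∀ n : SimplexCategory, X.obj (op n) → C(stdSimplex ℝ (Fin (n.len + 1)), Z))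
    (hf : ∀ (n m : SimplexCategory) (θ : n ⟶ m) (x : X.obj (op m))
      (t : stdSimplex ℝ (Fin (n.len + 1))),
      f n (X.map θ.op x) t = f m x (stdSimplex.map θ t))
    {n : SimplexCategory} (x : X.obj (op n)) (t : stdSimplex ℝ (Fin (n.len + 1))) :
    toTopDesc f hf (simplexMap x t) = f n x t := by
  have h := (sSetTopAdj.homEquiv_unit (X := X) (Y := Z) (f := toTopDesc f hf)).symm.trans
    ((sSetTopAdj.homEquiv X Z).apply_symm_apply _)
  have h' := congr($(congr_app h (op n)) x)
  exact (congr(TopCat.toSSetObjEquiv _ (op n) $h' t)).trans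
    congr($((TopCat.toSSetObjEquiv Z (op n)).apply_symm_apply (f n x)) t)

lemma toTop_hom_ext {Z : TopCat.{0}} {f g : SSet.toTop.obj X ⟶ Z}
    (h : ∀ (n : SimplexCategory) (x : X.obj (op n)) (t : stdSimplex ℝ (Fin (n.len + 1))),
      f (simplexMap x t) = g (simplexMap x t)) : f = g := by
  apply (sSetTopAdj.homEquiv X Z).injective
  rw [sSetTopAdj.homEquiv_unit, sSetTopAdj.homEquiv_unit]
  ext n x
  refine (TopCat.toSSetObjEquiv Z n).injective (ContinuousMap.ext fun t => ?_)
  exact h n.unop x t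

/-- Every function into an indiscrete space is continuous. Comparing the predicate "lies in a cell"
with the constant `True`, as maps into indiscrete `Prop`, turns the uniqueness half of the universal
property into a statement about points. -/
lemma exists_simplexMap_eq (p : SSet.toTop.obj X) :
    ∃ (n : SimplexCategory) (x : X.obj (op n)) (t : stdSimplex ℝ (Fin (n.len + 1))),
      simplexMap x t = p := by
  let Z : TopCat.{0} := @TopCat.of Prop ⊤
  let f : SSet.toTop.obj X ⟶ Z := @TopCat.ofHom _ Prop _ ⊤ (@ContinuousMap.mk _ _ _ ⊤
    (fun p => ∃ (n : SimplexCategory) (x : X.obj (op n)) (t : stdSimplex ℝ (Fin (n.len + 1))),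
      simplexMap x t = p) continuous_top)
  let g : SSet.toTop.obj X ⟶ Z := @TopCat.ofHom _ Prop _ ⊤ (@ContinuousMap.mk _ _ _ ⊤
    (fun _ => True) continuous_top)
  have : f = g := toTop_hom_ext fun n x t => eq_true ⟨n, x, t, rfl⟩
  exact of_eq_true congr($this p)

lemma toTop_funext {Z : Type*} {f g : SSet.toTop.obj X → Z}
    (h : ∀ (n : SimplexCategory) (x : X.obj (op n)) (t : stdSimplex ℝ (Fin (n.len + 1))),
      f (simplexMap x t) = g (simplexMap x t)) : f = g := by
  funext p
  obtain ⟨n, x, t, rfl⟩ := exists_simplexMap_eq p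
  exact h n x t

/-- The simplicial set with `n`-simplices the `(n + 1)`-tuples of elements of `S`. -/
def tuples (S : Type) : SSet.{0} where
  obj n := Fin (n.unop.len + 1) → S
  map f := ↾fun x => x ∘ f.unop.toOrderHom

/-- Functoriality of `tuples`. -/
def tuplesMap {S T : Type} (f : S → T) : tuples S ⟶ tuples T where
  app n := ↾fun x => f ∘ x

/-! ### Contractibility of the realization of `tuples S` -/

lemma stdSimplex_map_apply {X Y : Type*} [Fintype X] [Fintype Y] [DecidableEq Y] (f : X → Y)
    (t : stdSimplex ℝ X) (y : Y) :
    stdSimplex.map f t y = ∑ x, if f x = y then t x else 0 := by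
  rw [stdSimplex.map_coe, FunOnFinite.linearMap_apply_apply, Finset.sum_filter]

/-- The point of the `(n + 1)`-simplex with coordinates `(1 - s, s t₀, …, s tₙ)`. -/
def joinPoint {n : ℕ} (t : stdSimplex ℝ (Fin (n + 1))) (s : unitInterval) :
    stdSimplex ℝ (Fin (n + 2)) :=
  ⟨Fin.cons (1 - (s : ℝ)) fun i => s * t i, by
    constructor
    · intro i
      cases i using Fin.cases with
      | zero => simpa using s.2.2
      | succ i => exact mul_nonneg s.2.1 (t.2.1 i)
    · rw [Fin.sum_univ_succ]
      simp only [Fin.cons_zero, Fin.cons_succ]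
      rw [← Finset.mul_sum, stdSimplex.sum_eq_one]
      ring⟩

@[simp]
lemma joinPoint_zero {n : ℕ} (t : stdSimplex ℝ (Fin (n + 1))) (s : unitInterval) :
    joinPoint t s 0 = 1 - s := rfl

@[simp]
lemma joinPoint_succ {n : ℕ} (t : stdSimplex ℝ (Fin (n + 1))) (s : unitInterval)
    (i : Fin (n + 1)) : joinPoint t s i.succ = s * t i := rfl

lemma continuous_joinPoint (n : ℕ) :
    Continuous fun p : stdSimplex ℝ (Fin (n + 1)) × unitInterval => joinPoint p.1 p.2 := by
  refine Continuous.subtype_mk (continuous_pi fun i => ?_) _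
  cases i using Fin.cases with
  | zero => exact continuous_const.sub (continuous_subtype_val.comp continuous_snd)
  | succ i =>
    exact (continuous_subtype_val.comp continuous_snd).mul
      (((continuous_apply i).comp continuous_subtype_val).comp continuous_fst)

/-- The extension of a map in the simplex category preserving a new initial vertex. -/
def consHom {n m : SimplexCategory} (θ : n ⟶ m) :
    SimplexCategory.mk (n.len + 1) ⟶ SimplexCategory.mk (m.len + 1) :=
  SimplexCategory.Hom.mk
    { toFun := Fin.cons 0 fun i => (θ i).succ
      monotone' := fun i j hij => by
        cases i using Fin.cases with
        | zero => simp
        | succ i =>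
          cases j using Fin.cases with
          | zero => exact absurd hij (by simp)
          | succ j => exact Fin.succ_le_succ_iff.2 (θ.toOrderHom.monotone (Fin.succ_le_succ_iff.1 hij)) }

lemma map_consHom_joinPoint {n m : SimplexCategory} (θ : n ⟶ m)
    (t : stdSimplex ℝ (Fin (n.len + 1))) (s : unitInterval) :
    stdSimplex.map (consHom θ) (joinPoint t s) = joinPoint (stdSimplex.map θ t) s := by
  have h₀ : consHom θ (0 : Fin (n.len + 2)) = (0 : Fin (m.len + 2)) := rfl
  have h₁ : ∀ i : Fin (n.len + 1), consHom θ i.succ = (θ i).succ := fun _ => rfl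
  ext j
  refine (stdSimplex_map_apply (consHom θ) (joinPoint t s) j).trans ?_
  refine (Fin.sum_univ_succ _).trans ?_
  simp only [h₀, h₁]
  cases j using Fin.cases with
  | zero => simp
  | succ j =>
    simp [-stdSimplex.map_coe, stdSimplex_map_apply, Finset.mul_sum, (Fin.succ_ne_zero j).symm]

variable {S : Type} (b : S)

lemma cons_comp_consHom {n m : SimplexCategory} (θ : n ⟶ m) (x : Fin (m.len + 1) → S) :
    (Fin.cons b x : Fin (m.len + 2) → S) ∘ consHom θ =
      (Fin.cons b (x ∘ θ) : Fin (n.len + 2) → S) := by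
  funext i
  cases i using Fin.cases with
  | zero => rfl
  | succ i => rfl

/-- The simplex of `tuples S` given by a tuple. -/
abbrev tupleMap {n : ℕ} (x : Fin (n + 1) → S) :
    C(stdSimplex ℝ (Fin (n + 1)), SSet.toTop.obj (tuples S)) :=
  simplexMap (X := tuples S) (n := SimplexCategory.mk n) x

lemma tupleMap_comp {n m : SimplexCategory} (θ : n ⟶ m) (x : Fin (m.len + 1) → S)
    (t : stdSimplex ℝ (Fin (n.len + 1))) :
    tupleMap (x ∘ θ) t = tupleMap x (stdSimplex.map θ t) :=
  simplexMap_map (X := tuples S) θ x t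

/-- The vertex of the realization of `tuples S` given by an element of `S`. -/
def vertexPoint : SSet.toTop.obj (tuples S) :=
  tupleMap (fun _ : Fin 1 => b) default

/-- The cone on a simplex of `tuples S`, as a family of paths. -/
def conePath (n : SimplexCategory) (x : Fin (n.len + 1) → S) :
    C(stdSimplex ℝ (Fin (n.len + 1)), C(unitInterval, SSet.toTop.obj (tuples S))) :=
  ContinuousMap.curry
    ⟨fun p => tupleMap (Fin.cons b x : Fin (n.len + 2) → S) (joinPoint p.1 p.2),
      (map_continuous _).comp (continuous_joinPoint _)⟩

lemma conePath_comp (n m : SimplexCategory) (θ : n ⟶ m) (x : Fin (m.len + 1) → S)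
    (t : stdSimplex ℝ (Fin (n.len + 1))) :
    conePath b n (x ∘ θ) t = conePath b m x (stdSimplex.map θ t) := by
  ext s
  change tupleMap (Fin.cons b (x ∘ θ) : Fin (n.len + 2) → S) (joinPoint t s) =
    tupleMap (Fin.cons b x : Fin (m.len + 2) → S) (joinPoint (stdSimplex.map θ t) s)
  rw [← cons_comp_consHom, tupleMap_comp (consHom θ), map_consHom_joinPoint]

/-- The contraction of the realization of `tuples S`. -/
def contraction : SSet.toTop.obj (tuples S) ⟶
    TopCat.of C(unitInterval, SSet.toTop.obj (tuples S)) :=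
  -- Mapping into the path space lets the homotopy be built cell by cell, without knowing that
  -- realization commutes with the product with an interval.
  toTopDesc (X := tuples S) (Z := TopCat.of C(unitInterval, SSet.toTop.obj (tuples S)))
    (conePath b) (conePath_comp b)

lemma contraction_simplexMap {n : SimplexCategory} (x : Fin (n.len + 1) → S)
    (t : stdSimplex ℝ (Fin (n.len + 1))) (s : unitInterval) :
    (contraction b (tupleMap x t) : C(unitInterval, SSet.toTop.obj (tuples S))) s =
      tupleMap (Fin.cons b x : Fin (n.len + 2) → S) (joinPoint t s) :=
  DFunLike.congr_fun (toTopDesc_simplexMap (X := tuples S)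
    (Z := TopCat.of C(unitInterval, SSet.toTop.obj (tuples S)))
    (conePath b) (conePath_comp b) x t) s

lemma contraction_zero (p : SSet.toTop.obj (tuples S)) :
    (contraction b p : C(unitInterval, SSet.toTop.obj (tuples S))) 0 = vertexPoint b := by
  obtain ⟨n, x, t, rfl⟩ := exists_simplexMap_eq p
  refine (contraction_simplexMap b x t 0).trans ?_
  -- At time 0 the join point is the cone vertex, the image of the 0-simplex under the operator
  -- selecting vertex 0.
  have h := tupleMap_comp (SimplexCategory.const (SimplexCategory.mk 0)
    (SimplexCategory.mk (n.len + 1)) 0) (Fin.cons b x : Fin (n.len + 2) → S) default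
  refine Eq.trans ?_ h.symm
  congr 1
  ext j
  refine Eq.trans ?_ (stdSimplex_map_apply (X := Fin 1) _ default j).symm
  have h₀ : ∀ i : Fin 1, SimplexCategory.const (SimplexCategory.mk 0)
    (SimplexCategory.mk (n.len + 1)) 0 i = (0 : Fin (n.len + 2)) := fun _ => rfl
  simp only [h₀]
  cases j using Fin.cases with
  | zero => simp
  | succ j => simp [(Fin.succ_ne_zero j).symm]

lemma contraction_one (p : SSet.toTop.obj (tuples S)) :
    (contraction b p : C(unitInterval, SSet.toTop.obj (tuples S))) 1 = p := by
  obtain ⟨n, x, t, rfl⟩ := exists_simplexMap_eq p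
  refine (contraction_simplexMap b x t 1).trans ?_
  -- At time 1 the join point lies in the face opposite the cone vertex, which is the original
  -- simplex.
  have h := tupleMap_comp (n := n) (m := SimplexCategory.mk (n.len + 1))
    (SimplexCategory.δ (n := n.len) 0) (Fin.cons b x : Fin (n.len + 2) → S) t
  refine Eq.trans ?_ h.symm
  congr 1
  ext j
  refine Eq.trans ?_ (stdSimplex_map_apply (X := Fin (n.len + 1)) _ t j).symm
  have h₀ : ∀ i : Fin (n.len + 1), SimplexCategory.δ (n := n.len) 0 i = i.succ := fun i =>
    congrFun Fin.succAbove_zero i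
  simp only [h₀]
  cases j using Fin.cases with
  | zero => simp
  | succ j => simp

/-- The realization of `tuples S` deforms to a vertex. -/
def contractionHomotopy : ContinuousMap.Homotopy
    (ContinuousMap.const (SSet.toTop.obj (tuples S)) (vertexPoint b)) (ContinuousMap.id _) where
  toFun p := (contraction b p.2 : C(unitInterval, SSet.toTop.obj (tuples S))) p.1
  continuous_toFun := by
    have h : Continuous (contraction b) := (contraction b).hom.continuous
    -- Evaluation of paths is jointly continuous because the interval is locally compact.
    fun_prop
  map_zero_left p := contraction_zero b p
  map_one_left p := contraction_one b p

/-! ### Step functions -/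

/-- `k` is the index of the subinterval of `[0, 1)` containing `s`, for the subdivision into
intervals of lengths `t₀, …, tₙ`. -/
def IsIndex {n : ℕ} (t : stdSimplex ℝ (Fin n)) (s : ℝ) (k : Fin n) : Prop :=
  (∑ i, if i < k then t i else 0) ≤ s ∧ s < ∑ i, if i ≤ k then t i else 0

lemma sum_ite_mono {X : Type*} [Fintype X] (t : stdSimplex ℝ X) {p q : X → Prop}
    [DecidablePred p] [DecidablePred q] (h : ∀ i, p i → q i) :
    (∑ i, if p i then t i else 0) ≤ ∑ i, if q i then t i else 0 := by
  refine Finset.sum_le_sum fun i _ => ?_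
  have := t.2.1 i
  by_cases hp : p i
  · simp [hp, h i hp]
  · simp only [hp, if_false]
    split_ifs
    exacts [this, le_rfl]

lemma exists_isIndex {n : ℕ} (t : stdSimplex ℝ (Fin n)) (s : Set.Ico (0 : ℝ) 1) :
    ∃ k, IsIndex t s k := by
  classical
  have h₁ := stdSimplex.sum_eq_one t
  cases n with
  | zero => simp at h₁
  | succ n =>
    let p : ℕ → Prop := fun k => (s : ℝ) < ∑ i : Fin (n + 1), if (i : ℕ) ≤ k then t i else 0
    have hp : ∃ k, p k := by
      refine ⟨n, ?_⟩
      have : ∀ i : Fin (n + 1), (i : ℕ) ≤ n := fun i => by lia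
      simp only [p, this, if_true, h₁]
      exact s.2.2
    have hn : Nat.find hp < n + 1 := by
      refine Nat.lt_succ_of_le (Nat.find_min' hp ?_)
      have : ∀ i : Fin (n + 1), (i : ℕ) ≤ n := fun i => by lia
      simp only [p, this, if_true, h₁]
      exact s.2.2
    refine ⟨⟨Nat.find hp, hn⟩, ?_, ?_⟩
    · rcases Nat.eq_zero_or_pos (Nat.find hp) with h0 | h0
      · simp only [Fin.lt_def, h0, not_lt_zero, if_false, Finset.sum_const_zero]
        exact s.2.1
      · have := Nat.find_min hp (Nat.sub_lt h0 one_pos)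
        refine le_trans (sum_ite_mono t fun i hi => ?_) (not_lt.1 this)
        have : (i : ℕ) < Nat.find hp := hi
        lia
    · exact Nat.find_spec hp

lemma IsIndex.not_lt {n : ℕ} {t : stdSimplex ℝ (Fin n)} {s : ℝ} {k l : Fin n}
    (hk : IsIndex t s k) (hl : IsIndex t s l) : ¬ k < l := fun h =>
  absurd (hk.2.trans_le ((sum_ite_mono t fun _ hi => lt_of_le_of_lt hi h).trans hl.1)) (lt_irrefl s)

lemma IsIndex.unique {n : ℕ} {t : stdSimplex ℝ (Fin n)} {s : ℝ} {k l : Fin n}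
    (hk : IsIndex t s k) (hl : IsIndex t s l) : k = l :=
  le_antisymm (le_of_not_gt (hl.not_lt hk)) (le_of_not_gt (hk.not_lt hl))

/-- The index of the subinterval of `[0, 1)` containing `s`. -/
def index {n : ℕ} (t : stdSimplex ℝ (Fin n)) (s : Set.Ico (0 : ℝ) 1) : Fin n :=
  (exists_isIndex t s).choose

lemma isIndex_index {n : ℕ} (t : stdSimplex ℝ (Fin n)) (s : Set.Ico (0 : ℝ) 1) :
    IsIndex t s (index t s) := (exists_isIndex t s).choose_spec

lemma sum_ite_map {X Y : Type*} [Fintype X] [Fintype Y] [DecidableEq Y] (f : X → Y)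
    (t : stdSimplex ℝ X) (p : Y → Prop) [DecidablePred p] :
    (∑ y, if p y then stdSimplex.map f t y else 0) = ∑ x, if p (f x) then t x else 0 := by
  simp_rw [stdSimplex_map_apply, ← Finset.sum_filter]
  rw [Finset.sum_congr rfl fun y _ => Finset.sum_filter _ _, Finset.sum_comm, Finset.sum_filter]
  refine Finset.sum_congr rfl fun x _ => ?_
  rw [Finset.sum_ite_eq]
  simp

/-- A monotone map only merges consecutive subintervals or inserts empty ones, so step functions
respect simplicial operators and descend to the realization. -/
lemma index_map {n m : ℕ} (θ : Fin n →o Fin m) (t : stdSimplex ℝ (Fin n))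
    (s : Set.Ico (0 : ℝ) 1) : index (stdSimplex.map θ t) s = θ (index t s) := by
  refine (isIndex_index _ s).unique ⟨?_, ?_⟩
  · rw [sum_ite_map θ t]
    exact (sum_ite_mono t fun i hi => lt_of_not_ge fun h => absurd hi (not_lt.2 (θ.monotone h))).trans
      (isIndex_index t s).1
  · rw [sum_ite_map θ t]
    exact (isIndex_index t s).2.trans_le (sum_ite_mono t fun i hi => θ.monotone hi)

/-- The index at s can change only if some division point moves past s. The set where two step
functions differ is thus covered by finitely many intervals, with lengths tending to 0 as t' tends
to t. -/
lemma mem_uIcc_of_index_ne {n : ℕ} (t t' : stdSimplex ℝ (Fin n)) (s : Set.Ico (0 : ℝ) 1)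
    (h : index t s ≠ index t' s) :
    ∃ k, (s : ℝ) ∈ Set.uIcc (∑ i, if i ≤ k then t i else 0) (∑ i, if i ≤ k then t' i else 0) := by
  have h₁ := isIndex_index t s
  have h₂ := isIndex_index t' s
  rcases lt_or_gt_of_ne h with h | h
  · exact ⟨index t s, Set.mem_uIcc.2 (.inr ⟨(sum_ite_mono t' fun i hi => lt_of_le_of_lt hi h).trans
      h₂.1, h₁.2.le⟩)⟩
  · exact ⟨index t' s, Set.mem_uIcc.2 (.inl ⟨(sum_ite_mono t fun i hi => lt_of_le_of_lt hi h).trans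
      h₁.1, h₂.2.le⟩)⟩

/-- Functions on `[0, 1)`, with the distance given by the measure of the set where two functions
differ. -/
structure StepFunction (S : Type) where
  /-- the underlying function -/
  toFun : Set.Ico (0 : ℝ) 1 → S

-- Monotonicity and subadditivity of outer measure suffice for the triangle inequality, so arbitrary
-- functions are allowed and no measurability is imposed.
open MeasureTheory in
instance (S : Type) : PseudoEMetricSpace (StepFunction S) where
  edist f h := volume (Subtype.val '' {s | f.toFun s ≠ h.toFun s})
  edist_self f := by simp
  edist_comm f h := by simp only [ne_comm]
  edist_triangle f h k := by
    refine (measure_mono ?_).trans (measure_union_le _ _)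
    rw [← Set.image_union]
    refine Set.image_mono fun s hs => ?_
    by_contra hc
    simp only [Set.mem_union, Set.mem_ofPred_eq, not_or, not_not] at hc
    exact hs (hc.1.trans hc.2)

lemma StepFunction.edist_def {S : Type} (f h : StepFunction S) :
    edist f h = MeasureTheory.volume (Subtype.val '' {s | f.toFun s ≠ h.toFun s}) := rfl

variable {S : Type}

lemma edist_comp_index_le {n : ℕ} (x : Fin n → S) (t t' : stdSimplex ℝ (Fin n)) :
    edist (StepFunction.mk fun s => x (index t s)) ⟨fun s => x (index t' s)⟩ ≤
      ∑ k, ENNReal.ofReal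
        |(∑ i, if i ≤ k then t' i else 0) - (∑ i, if i ≤ k then t i else 0)| := by
  rw [StepFunction.edist_def]
  refine (MeasureTheory.measure_mono (t := ⋃ k, Set.uIcc (∑ i, if i ≤ k then t i else 0)
    (∑ i, if i ≤ k then t' i else 0)) ?_).trans
    ((MeasureTheory.measure_iUnion_fintype_le _ _).trans ?_)
  · rintro _ ⟨s, hs, rfl⟩
    exact Set.mem_iUnion.2 (mem_uIcc_of_index_ne t t' s fun h => hs (congrArg x h))
  · simp only [Real.volume_interval, le_refl]

/-- The step function with values the entries of a tuple. -/
def stepMap (n : SimplexCategory) (x : Fin (n.len + 1) → S) :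
    C(stdSimplex ℝ (Fin (n.len + 1)), StepFunction S) where
  toFun t := ⟨fun s => x (index t s)⟩
  continuous_toFun := by
    refine continuous_iff_continuousAt.2 fun t => tendsto_iff_edist_tendsto_0.2 ?_
    have hc : Continuous fun t' : stdSimplex ℝ (Fin (n.len + 1)) => ∑ k, ENNReal.ofReal
        |(∑ i, if i ≤ k then t i else 0) - (∑ i, if i ≤ k then t' i else 0)| := by
      refine continuous_finsetSum _ fun k _ => ENNReal.continuous_ofReal.comp
        (continuous_const.sub (continuous_finsetSum _ fun i _ => ?_)).abs
      split_ifs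
      · exact (continuous_apply i).comp continuous_subtype_val
      · exact continuous_const
    have h0 := hc.tendsto t
    simp only [sub_self, abs_zero, ENNReal.ofReal_zero, Finset.sum_const_zero] at h0
    exact tendsto_of_tendsto_of_tendsto_of_le_of_le tendsto_const_nhds h0 (fun _ => zero_le)
      fun t' => edist_comp_index_le x t' t

/-- The step function at a point of the realization of `tuples S`. -/
def toStepFunction : SSet.toTop.obj (tuples S) ⟶ TopCat.of (StepFunction S) :=
  toTopDesc (X := tuples S) (Z := TopCat.of (StepFunction S)) stepMap fun n m θ x t => by
    refine congrArg StepFunction.mk (funext fun s => ?_)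
    exact congrArg x (index_map θ.toOrderHom t s).symm

lemma toStepFunction_tupleMap {n : ℕ} (x : Fin (n + 1) → S) (t : stdSimplex ℝ (Fin (n + 1)))
    (s : Set.Ico (0 : ℝ) 1) :
    (toStepFunction (tupleMap x t) : StepFunction S).toFun s = x (index t s) :=
  congrArg (fun f : StepFunction S => f.toFun s)
    (toTopDesc_simplexMap (X := tuples S) (Z := TopCat.of (StepFunction S)) stepMap _
      (n := SimplexCategory.mk n) x t)

lemma toStepFunction_map {T : Type} (f : S → T) (p : SSet.toTop.obj (tuples S))
    (s : Set.Ico (0 : ℝ) 1) :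
    (toStepFunction (SSet.toTop.map (tuplesMap f) p) : StepFunction T).toFun s =
      f ((toStepFunction p : StepFunction S).toFun s) := by
  obtain ⟨n, x, t, rfl⟩ := exists_simplexMap_eq p
  rw [toTop_map_simplexMap]
  exact (toStepFunction_tupleMap (f ∘ x) t s).trans
    (congrArg f (toStepFunction_tupleMap x t s)).symm

/-- A left inverse of f induces a retraction of realizations. It exists only when S is nonempty;
otherwise the realization has no points. -/
lemma injective_toTop_map_tuplesMap {T : Type} (f : S → T) (hf : Function.Injective f) :
    Function.Injective (SSet.toTop.map (tuplesMap f)) := by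
  cases isEmpty_or_nonempty S with
  | inl h =>
    intro p
    obtain ⟨n, x, t, rfl⟩ := exists_simplexMap_eq p
    exact isEmptyElim ((x : Fin (n.len + 1) → S) 0)
  | inr h =>
    obtain ⟨r, hr⟩ := hf.hasLeftInverse
    have h : tuplesMap f ≫ tuplesMap r = 𝟙 _ := by
      ext n x
      funext i
      exact hr _
    have h' : SSet.toTop.map (tuplesMap f) ≫ SSet.toTop.map (tuplesMap r) = 𝟙 _ := by
      rw [← Functor.map_comp, h, CategoryTheory.Functor.map_id]
    exact Function.LeftInverse.injective fun p => congr($h' p)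

variable (Γ : Type)

/-! ### The universal cover of the classifying space -/

/-- A contractible space with a free action of `Γ`. -/
def universalSpace : TopCat.{0} := SSet.toTop.obj (tuples Γ)

variable {Γ}

/-- The simplex of the universal space given by a tuple. -/
def cell {n : ℕ} (x : Fin (n + 1) → Γ) : C(stdSimplex ℝ (Fin (n + 1)), universalSpace Γ) :=
  tupleMap x

lemma universalSpace_funext {Z : Type*} {f g : universalSpace Γ → Z}
    (h : ∀ (n : ℕ) (x : Fin (n + 1) → Γ) (t : stdSimplex ℝ (Fin (n + 1))),
      f (cell x t) = g (cell x t)) : f = g :=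
  toTop_funext fun n x t => h n.len x t

/-- The step function at a point of the universal space. -/
def stepFunction (p : universalSpace Γ) : StepFunction Γ := toStepFunction p

lemma continuous_stepFunction : Continuous (stepFunction (Γ := Γ)) :=
  toStepFunction.hom.continuous

variable [Group Γ]

/-- The action of an element of `Γ` on the universal space. -/
def translate (g : Γ) : universalSpace Γ ⟶ universalSpace Γ :=
  SSet.toTop.map (tuplesMap (g * ·))

lemma translate_cell (g : Γ) {n : ℕ} (x : Fin (n + 1) → Γ) (t : stdSimplex ℝ (Fin (n + 1))) :
    translate g (cell x t) = cell (fun i => g * x i) t :=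
  toTop_map_simplexMap _ _ _

instance : MulAction Γ (universalSpace Γ) where
  smul g p := translate g p
  one_smul p := congrFun (universalSpace_funext (f := translate 1) (g := id) fun n x t => by
    simp only [translate_cell, one_mul, id]) p
  mul_smul g h p := congrFun (universalSpace_funext (f := translate (g * h))
    (g := fun p => translate g (translate h p)) fun n x t => by
    simp only [translate_cell, mul_assoc]) p

lemma smul_cell (g : Γ) {n : ℕ} (x : Fin (n + 1) → Γ) (t : stdSimplex ℝ (Fin (n + 1))) :
    g • cell x t = cell (fun i => g * x i) t :=
  translate_cell g x t

instance : ContinuousConstSMul Γ (universalSpace Γ) :=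
  ⟨fun g => (translate g).hom.continuous⟩

lemma stepFunction_smul (g : Γ) (p : universalSpace Γ) (s : Set.Ico (0 : ℝ) 1) :
    (stepFunction (g • p)).toFun s = g * (stepFunction p).toFun s :=
  toStepFunction_map _ p s

/-- For g ≠ 1 the step functions of gq and q differ everywhere on [0, 1), so their distance is 1,
and the preimage of a ball of radius 1/2 cannot meet its translate. -/
lemma exists_disjoint_nhds (p : universalSpace Γ) :
    ∃ U ∈ nhds p, ∀ g : Γ, ((g • ·) '' U ∩ U).Nonempty → g = 1 := by
  refine ⟨{q | edist (stepFunction q) (stepFunction p) < 1 / 2}, ?_, ?_⟩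
  · refine IsOpen.mem_nhds ?_ (by simp)
    exact isOpen_lt (continuous_stepFunction.edist continuous_const) continuous_const
  · rintro g ⟨_, ⟨q, hq, rfl⟩, hq'⟩
    by_contra hg
    have h₁ : edist (stepFunction (g • q)) (stepFunction q) = 1 := by
      rw [StepFunction.edist_def, show {s | (stepFunction (g • q)).toFun s ≠
        (stepFunction q).toFun s} = Set.univ from Set.eq_univ_of_forall fun s => ?_]
      · rw [Set.image_univ, Subtype.range_coe, Real.volume_Ico]
        simp
      · rw [Set.mem_ofPred_eq, stepFunction_smul]
        simpa using hg
    have h₂ := (edist_triangle_right (stepFunction (g • q)) (stepFunction q)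
      (stepFunction p)).trans_lt (ENNReal.add_lt_add hq' hq)
    rw [h₁, ENNReal.add_halves] at h₂
    exact lt_irrefl _ h₂

/-- An equivariant (discontinuous) map from the universal space to `Γ`. -/
def label (p : universalSpace Γ) : Γ := (stepFunction p).toFun ⟨0, by simp⟩

lemma label_smul (g : Γ) (p : universalSpace Γ) : label (g • p) = g * label p :=
  stepFunction_smul g p _

lemma eq_one_of_smul_eq (g : Γ) (p : universalSpace Γ) (h : g • p = p) : g = 1 := by
  have := label_smul g p
  rw [h] at this
  simpa using this.symm

/-! ### The classifying space as orbit space -/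

/-- The simplex of the nerve of `Γ` with edges the quotients of the entries of a tuple. -/
def quotientFunctor {n : ℕ} (x : Fin (n + 1) → Γ) : ComposableArrows (SingleObj Γ) n where
  obj _ := SingleObj.star Γ
  -- The order of the factors is forced: f ≫ g is g * f in `SingleObj`, and left translation of the
  -- tuple must cancel.
  map {i j} _ := ((x j)⁻¹ * x i : Γ)
  map_id i := inv_mul_cancel (x i)
  map_comp {i j k} _ _ := by
    rw [SingleObj.comp_as_mul]
    group

lemma quotientFunctor_smul (g : Γ) {n : ℕ} (x : Fin (n + 1) → Γ) :
    quotientFunctor (fun i => g * x i) = quotientFunctor x := by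
  refine CategoryTheory.Functor.ext (fun _ => rfl) fun i j f => ?_
  simp [quotientFunctor, mul_assoc]

lemma exists_eq_smul_of_quotientFunctor_eq {n : ℕ} {x y : Fin (n + 1) → Γ}
    (h : quotientFunctor x = quotientFunctor y) : ∃ g : Γ, x = fun i => g * y i := by
  refine ⟨x 0 * (y 0)⁻¹, funext fun i => ?_⟩
  have := Functor.congr_hom h (homOfLE (Fin.zero_le i))
  simp only [quotientFunctor, eqToHom_refl, Category.comp_id, Category.id_comp] at this
  have h' : (x i)⁻¹ * x 0 = (y i)⁻¹ * y 0 := this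
  have : x i = x 0 * ((x i)⁻¹ * x 0)⁻¹ := by group
  rw [this, h']
  group

lemma surjective_quotientFunctor {n : ℕ} (F : ComposableArrows (SingleObj Γ) n) :
    ∃ x : Fin (n + 1) → Γ, quotientFunctor x = F := by
  -- The preimage normalized to have identity as its zeroth entry.
  refine ⟨fun i => (show Γ from F.map (homOfLE (Fin.zero_le i)))⁻¹, ?_⟩
  refine CategoryTheory.Functor.ext (fun _ => rfl) fun i j f => ?_
  simp only [quotientFunctor, eqToHom_refl, Category.comp_id, Category.id_comp, inv_inv]
  have h : F.map (homOfLE (Fin.zero_le j)) = F.map (homOfLE (Fin.zero_le i)) ≫ F.map f :=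
    F.map_comp _ _
  have h' : (F.map (homOfLE (Fin.zero_le j)) : Γ) =
    (F.map f : Γ) * (F.map (homOfLE (Fin.zero_le i)) : Γ) := h
  exact mul_inv_eq_of_eq_mul h'

variable (Γ) in
/-- The simplicial map underlying the universal covering of the classifying space. -/
def toNerve : tuples Γ ⟶ nerve (SingleObj Γ) where
  app n := ↾fun x => quotientFunctor (n := n.unop.len) x
  naturality _ _ _ := rfl

variable (Γ) in
/-- The universal covering of the classifying space. -/
def covering : universalSpace Γ ⟶ TruncatedComplex.classifyingSpace Γ :=
  SSet.toTop.map (toNerve Γ)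

lemma covering_cell {n : ℕ} (x : Fin (n + 1) → Γ) (t : stdSimplex ℝ (Fin (n + 1))) :
    covering Γ (cell x t) = simplexMap (X := nerve (SingleObj Γ))
      (n := SimplexCategory.mk n) (quotientFunctor x) t :=
  toTop_map_simplexMap _ _ _

lemma covering_smul (g : Γ) (p : universalSpace Γ) : covering Γ (g • p) = covering Γ p :=
  congrFun (universalSpace_funext (f := fun p => covering Γ (g • p)) (g := covering Γ)
    fun n x t => by rw [smul_cell, covering_cell, covering_cell, quotientFunctor_smul]) p

/-- The orbit of a point of the universal space. -/
def orbitMk (p : universalSpace Γ) : MulAction.orbitRel.Quotient Γ (universalSpace Γ) :=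
  Quotient.mk _ p

lemma continuous_orbitMk : Continuous (orbitMk (Γ := Γ)) := continuous_quotient_mk'

lemma orbitMk_cell_eq {n : ℕ} {x y : Fin (n + 1) → Γ}
    (h : quotientFunctor x = quotientFunctor y) (t : stdSimplex ℝ (Fin (n + 1))) :
    orbitMk (cell x t) = orbitMk (cell y t) := by
  obtain ⟨g, rfl⟩ := exists_eq_smul_of_quotientFunctor_eq h
  exact Quotient.sound ⟨g, smul_cell g y t⟩

/-- The map from a simplex of the nerve to the orbit space. -/
def orbitSimplex (n : SimplexCategory) (F : ComposableArrows (SingleObj Γ) n.len) :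
    C(stdSimplex ℝ (Fin (n.len + 1)), MulAction.orbitRel.Quotient Γ (universalSpace Γ)) :=
  ⟨fun t => orbitMk (cell (surjective_quotientFunctor F).choose t),
    continuous_orbitMk.comp (map_continuous (cell _))⟩

lemma orbitSimplex_quotientFunctor (n : SimplexCategory) (x : Fin (n.len + 1) → Γ)
    (t : stdSimplex ℝ (Fin (n.len + 1))) :
    orbitSimplex n (quotientFunctor x) t = orbitMk (cell x t) :=
  orbitMk_cell_eq (surjective_quotientFunctor (quotientFunctor x)).choose_spec t

lemma orbitSimplex_map (n m : SimplexCategory) (θ : n ⟶ m)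
    (F : ComposableArrows (SingleObj Γ) m.len) (t : stdSimplex ℝ (Fin (n.len + 1))) :
    orbitSimplex n ((nerve (SingleObj Γ)).map θ.op F) t = orbitSimplex m F (stdSimplex.map θ t) := by
  obtain ⟨x, rfl⟩ := surjective_quotientFunctor F
  refine (orbitSimplex_quotientFunctor n (x ∘ θ) t).trans ?_
  refine Eq.trans ?_ (orbitSimplex_quotientFunctor m x _).symm
  exact congrArg orbitMk (tupleMap_comp θ x t)

variable (Γ) in
/-- The map from the classifying space to the orbit space. -/
def toOrbits : TruncatedComplex.classifyingSpace Γ ⟶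
    TopCat.of (MulAction.orbitRel.Quotient Γ (universalSpace Γ)) :=
  toTopDesc (X := nerve (SingleObj Γ))
    (Z := TopCat.of (MulAction.orbitRel.Quotient Γ (universalSpace Γ))) orbitSimplex
    orbitSimplex_map

lemma toOrbits_covering (p : universalSpace Γ) : toOrbits Γ (covering Γ p) = orbitMk p :=
  congrFun (universalSpace_funext (f := fun p => toOrbits Γ (covering Γ p)) (g := orbitMk)
    fun n x t => by
      rw [covering_cell]
      exact (toTopDesc_simplexMap (X := nerve (SingleObj Γ))
        (Z := TopCat.of (MulAction.orbitRel.Quotient Γ (universalSpace Γ))) orbitSimplex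
        orbitSimplex_map
        (n := SimplexCategory.mk n) (quotientFunctor x) t).trans
        (orbitSimplex_quotientFunctor (SimplexCategory.mk n) x t)) p

lemma surjective_covering : Function.Surjective (covering Γ) := fun q => by
  obtain ⟨n, F, t, rfl⟩ := exists_simplexMap_eq q
  obtain ⟨x, rfl⟩ := surjective_quotientFunctor F
  exact ⟨cell x t, covering_cell x t⟩

variable (Γ) in
/-- The classifying space is the orbit space of the universal space. -/
def orbitsHomeomorph : MulAction.orbitRel.Quotient Γ (universalSpace Γ) ≃ₜ
    TruncatedComplex.classifyingSpace Γ where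
  toFun := Quotient.lift (covering Γ) fun _ p ⟨g, hg⟩ => hg ▸ covering_smul g p
  invFun := toOrbits Γ
  left_inv := by
    rintro ⟨p⟩
    exact toOrbits_covering p
  right_inv q := by
    obtain ⟨p, rfl⟩ := surjective_covering q
    rw [toOrbits_covering]
    rfl
  continuous_toFun := (covering Γ).hom.continuous.quotient_lift _
  continuous_invFun := (toOrbits Γ).hom.continuous

/-- The orbit map of a properly discontinuous action is a covering. The homeomorphism
`orbitsHomeomorph`, whose inverse is defined cell by cell, carries this over to the classifying
space. -/
lemma isQuotientCoveringMap_covering : IsQuotientCoveringMap (covering Γ) Γ := by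
  have h : IsQuotientCoveringMap (orbitMk (Γ := Γ)) Γ :=
    { toIsQuotientMap := isQuotientMap_quotient_mk'
      continuous_const_smul := ContinuousConstSMul.continuous_const_smul
      apply_eq_iff_mem_orbit := Quotient.eq''
      disjoint := exists_disjoint_nhds }
  exact h.homeomorph_comp (orbitsHomeomorph Γ)

/-! ### Lifting simplices -/

instance (n : ℕ) : ContractibleSpace (stdSimplex ℝ (Fin (n + 1))) :=
  (convex_stdSimplex ℝ _).contractibleSpace ⟨_, (stdSimplex.vertex (S := ℝ) (0 : Fin (n + 1))).2⟩

instance (n : ℕ) : LocallyPathConnectedSpace (stdSimplex ℝ (Fin n)) :=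
  (convex_stdSimplex ℝ (Fin n)).locallyPathConnectedSpace

lemma exists_lift {n : ℕ} (f : C(stdSimplex ℝ (Fin (n + 1)), TruncatedComplex.classifyingSpace Γ)) :
    ∃ F : C(stdSimplex ℝ (Fin (n + 1)), universalSpace Γ), covering Γ ∘ F = f := by
  obtain ⟨e, he⟩ := surjective_covering (f (stdSimplex.vertex 0))
  obtain ⟨F, hF, -⟩ := isQuotientCoveringMap_covering.isCoveringMap.existsUnique_continuousMap_lifts
    f (stdSimplex.vertex 0) e he
  exact ⟨F, hF.2⟩

/-- At one vertex the two lifts differ by some g; then F and gF' are lifts of the same simplex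
agreeing at a point, hence equal. -/
lemma exists_smul_eq_of_covering_comp_eq {n : ℕ}
    {F F' : C(stdSimplex ℝ (Fin (n + 1)), universalSpace Γ)}
    (h : covering Γ ∘ F = covering Γ ∘ F') : ∃ g : Γ, ∀ t, F t = g • F' t := by
  obtain ⟨g, hg⟩ := isQuotientCoveringMap_covering.apply_eq_iff_mem_orbit.1 (congrFun h (stdSimplex.vertex 0))
  refine ⟨g, ?_⟩
  have hu := isQuotientCoveringMap_covering.isCoveringMap.existsUnique_continuousMap_lifts
    (⟨covering Γ ∘ F, (covering Γ).hom.continuous.comp (map_continuous F)⟩ :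
      C(stdSimplex ℝ (Fin (n + 1)), TruncatedComplex.classifyingSpace Γ)) (stdSimplex.vertex 0) (F (stdSimplex.vertex 0)) rfl
  have := hu.unique (y₁ := F) (y₂ := ⟨fun t => g • F' t, (map_continuous F').const_smul g⟩)
    ⟨rfl, rfl⟩ ⟨hg, funext fun t => (covering_smul g _).trans (congrFun h t).symm⟩
  exact fun t => DFunLike.congr_fun this t

/-! ### Subgroups -/

variable (H : Subgroup Γ)

/-- The inclusion of the universal space of a subgroup. -/
def universalInclusion : universalSpace H ⟶ universalSpace Γ :=
  SSet.toTop.map (tuplesMap H.subtype)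

lemma injective_universalInclusion : Function.Injective (universalInclusion H) :=
  injective_toTop_map_tuplesMap _ H.subtype_injective

lemma label_universalInclusion (p : universalSpace H) :
    label (universalInclusion H p) = label p :=
  toStepFunction_map _ p _

lemma universalInclusion_smul (h : H) (p : universalSpace H) :
    universalInclusion H (h • p) = (h : Γ) • universalInclusion H p :=
  congrFun (universalSpace_funext (f := fun p => universalInclusion H (h • p))
    (g := fun p => (h : Γ) • universalInclusion H p) fun n x t => by
      rw [smul_cell]
      refine (toTop_map_simplexMap _ _ _).trans ?_
      refine Eq.trans ?_ (congrArg (translate (h : Γ)) (toTop_map_simplexMap _ _ _)).symm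
      exact (translate_cell (h : Γ) _ t).symm) p

lemma covering_universalInclusion :
    universalInclusion H ≫ covering Γ =
      covering H ≫ TruncatedComplex.classifyingSpaceInclusion Γ H := by
  refine (SSet.toTop.map_comp _ _).symm.trans (Eq.trans ?_ (SSet.toTop.map_comp _ _))
  congr 1

end GeometricRealization

end

noncomputable section

open Opposite Simplicial Limits

/-! ### Simplicial chains as linear combinations of simplices -/

/-- The linear extension of a map to a module. -/
def ModuleCat.monoidAlgebraDesc {T : Type} {M : ModuleCat.{0} ℤ} (f : T → M) :
    ModuleCat.of ℤ (MonoidAlgebra ℤ T) ⟶ M :=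
  ModuleCat.ofHom (Finsupp.linearCombination ℤ f ∘ₗ
    (MonoidAlgebra.coeffLinearEquiv ℤ).toLinearMap)

lemma ModuleCat.monoidAlgebraDesc_single {T : Type} {M : ModuleCat.{0} ℤ} (f : T → M) (x : T) :
    (ModuleCat.monoidAlgebraDesc f).hom (MonoidAlgebra.single x 1) = f x := by
  refine (Finsupp.linearCombination_single ℤ 1 x).trans ?_
  exact M.isModule.one_smul (f x)

/-- The map `∐_T ℤ → ℤ[T]`. -/
def sigmaToFree (T : Type) : (∐ fun _ : T => ModuleCat.of ℤ ℤ) ⟶ ModuleCat.of ℤ (MonoidAlgebra ℤ T) :=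
  Sigma.desc fun x : T =>
    ModuleCat.ofHom (LinearMap.toSpanSingleton ℤ (MonoidAlgebra ℤ T) (MonoidAlgebra.single x 1))

lemma ι_sigmaToFree (T : Type) (x : T) :
    Sigma.ι (fun _ : T => ModuleCat.of ℤ ℤ) x ≫ sigmaToFree T =
      ModuleCat.ofHom
        (LinearMap.toSpanSingleton ℤ (MonoidAlgebra ℤ T) (MonoidAlgebra.single x 1)) :=
  Sigma.ι_desc _ _

lemma sigmaToFree_ι (T : Type) (x : T) :
    (sigmaToFree T).hom ((Sigma.ι (fun _ : T => ModuleCat.of ℤ ℤ) x).hom (1 : ℤ)) =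
      MonoidAlgebra.single x 1 :=
  (congr($(ι_sigmaToFree T x).hom (1 : ℤ))).trans (one_smul ℤ (MonoidAlgebra.single x (1 : ℤ)))

/-- The map `ℤ[T] → ∐_T ℤ`. -/
def freeToSigma (T : Type) : ModuleCat.of ℤ (MonoidAlgebra ℤ T) ⟶ ∐ fun _ : T => ModuleCat.of ℤ ℤ :=
  ModuleCat.monoidAlgebraDesc fun x : T =>
    (Sigma.ι (fun _ : T => ModuleCat.of ℤ ℤ) x).hom (1 : ℤ)

lemma freeToSigma_single (T : Type) (x : T) :
    (freeToSigma T).hom (MonoidAlgebra.single x 1) =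
      (Sigma.ι (fun _ : T => ModuleCat.of ℤ ℤ) x).hom (1 : ℤ) :=
  ModuleCat.monoidAlgebraDesc_single _ _

/-- The functor `T ↦ ∐_T ℤ` is the free module functor. -/
def sigmaConstIsoFree :
    sigmaConst.{0}.obj (ModuleCat.of ℤ ℤ) ≅ ModuleCat.monoidAlgebraFree.{0} ℤ :=
  NatIso.ofComponents (fun T =>
    { hom := sigmaToFree T
      inv := freeToSigma T
      hom_inv_id := by
        refine Sigma.hom_ext _ _ fun x => ModuleCat.hom_ext (LinearMap.ext_ring ?_)
        exact (congrArg (freeToSigma T).hom (sigmaToFree_ι T x)).trans (freeToSigma_single T x)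
      inv_hom_id := by
        refine ModuleCat.hom_ext (MonoidAlgebra.lhom_ext' fun x => LinearMap.ext_ring ?_)
        change (sigmaToFree T).hom ((freeToSigma T).hom (MonoidAlgebra.single x 1)) =
          MonoidAlgebra.single x 1
        rw [freeToSigma_single, sigmaToFree_ι] })
    fun {T T'} f => by
      refine Sigma.hom_ext _ _ fun x => ModuleCat.hom_ext (LinearMap.ext_ring ?_)
      have h₁ : Sigma.ι (fun _ : T => ModuleCat.of ℤ ℤ) x ≫
          (sigmaConst.{0}.obj (ModuleCat.of ℤ ℤ)).map f =
          Sigma.ι (fun _ : T' => ModuleCat.of ℤ ℤ) (f x) := by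
        simp [sigmaConst]
      refine (congr((sigmaToFree T').hom ($(h₁).hom (1 : ℤ)))).trans ?_
      rw [sigmaToFree_ι]
      refine Eq.trans ?_ (congrArg (MonoidAlgebra.mapDomainLinearMap ℤ ℤ f)
        (sigmaToFree_ι T x)).symm
      rw [MonoidAlgebra.mapDomainLinearMap_single]

/-- The chain complex of a simplicial set, with chains the linear combinations of simplices. -/
def freeChains : SSet.{0} ⥤ ChainComplex (ModuleCat.{0} ℤ) ℕ :=
  (SimplicialObject.whiskering _ _).obj (ModuleCat.monoidAlgebraFree ℤ) ⋙
    AlgebraicTopology.alternatingFaceMapComplex _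

/-- The comparison of the two chain complexes of a simplicial set. -/
def chainComplexIsoFreeChains :
    (SSet.chainComplexFunctor (ModuleCat.{0} ℤ)).obj (ModuleCat.of ℤ ℤ) ≅ freeChains :=
  Functor.isoWhiskerRight ((SimplicialObject.whiskering _ _).mapIso sigmaConstIsoFree)
    (AlgebraicTopology.alternatingFaceMapComplex _)

/-- The comparison of the two singular chain complexes of a space. -/
def singularChainsIso : TruncatedComplex.singularChains ≅ TopCat.toSSet ⋙ freeChains :=
  Functor.isoWhiskerLeft TopCat.toSSet chainComplexIsoFreeChains

/-- The chain given by a simplex. -/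
abbrev simplexChain {X : SSet.{0}} {n : ℕ} (x : X _⦋n⦌) : (freeChains.obj X).X n :=
  MonoidAlgebra.single (M := X _⦋n⦌) x (1 : ℤ)

lemma freeChains_map_f {X Y : SSet.{0}} (f : X ⟶ Y) {n : ℕ} (x : X _⦋n⦌) :
    (freeChains.map f).f n (simplexChain x) = simplexChain (f.app _ x) :=
  MonoidAlgebra.mapDomainLinearMap_single _ _ _

lemma freeChains_d {X : SSet.{0}} {n : ℕ} (x : X _⦋n + 1⦌) :
    (freeChains.obj X).d (n + 1) n (simplexChain x) =
      ∑ k : Fin (n + 2), (-1 : ℤ) ^ (k : ℕ) • simplexChain (X.δ k x) := by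
  refine (congr($(AlgebraicTopology.AlternatingFaceMapComplex.obj_d_eq
    (((SimplicialObject.whiskering _ _).obj (ModuleCat.monoidAlgebraFree ℤ)).obj X) n).hom
    (simplexChain x))).trans ?_
  rw [ModuleCat.hom_sum]
  refine (LinearMap.sum_apply _ _ _).trans ?_
  refine Finset.sum_congr rfl fun k _ => ?_
  refine (congr($(ModuleCat.hom_zsmul _ _) (simplexChain x))).trans ?_
  refine congrArg (fun y : (freeChains.obj X).X n => (-1 : ℤ) ^ (k : ℕ) • y) ?_
  exact MonoidAlgebra.mapDomainLinearMap_single _ _ _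

lemma freeChains_hom_ext {X : SSet.{0}} {n : ℕ} {M : ModuleCat.{0} ℤ}
    {f g : (freeChains.obj X).X n ⟶ M} (h : ∀ x : X _⦋n⦌, f (simplexChain x) = g (simplexChain x)) :
    f = g :=
  ModuleCat.hom_ext (MonoidAlgebra.lhom_ext' fun x => LinearMap.ext_ring (h x))

/-! ### Chains of spaces that deform onto a discrete set -/

section HomotopyDiscrete

variable {Y Q : TopCat.{0}} (q : Y ⟶ Q) (s : Q ⟶ Y) (h : TopCat.Homotopy (q ≫ s) (𝟙 Y))

/-- A homotopy of continuous maps induces a homotopy on chains. -/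
def freeChainsHomotopy {f g : Y ⟶ Q} (h : TopCat.Homotopy f g) :
    Homotopy (freeChains.map (TopCat.toSSet.map f)) (freeChains.map (TopCat.toSSet.map g)) := by
  have e : ∀ f : Y ⟶ Q, singularChainsIso.inv.app Y ≫ TruncatedComplex.singularChains.map f ≫
      singularChainsIso.hom.app Q = freeChains.map (TopCat.toSSet.map f) := fun f => by
    rw [singularChainsIso.hom.naturality, Iso.inv_hom_id_app_assoc]
    rfl
  exact ((Homotopy.ofEq (e f).symm).trans (((h.singularChainComplexFunctorObjMap
    (ModuleCat.of ℤ ℤ)).compRight _).compLeft _)).trans (Homotopy.ofEq (e g))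

-- If H is the chain homotopy from s∘q to the identity and dz = 0, then z = s(qz) - dHz = d(sw -
-- Hz). In positive degrees w comes from acyclicity of Q, in degree 0 it is taken to be 0.
include h in
lemma exists_d_eq_of_map_eq_d (n : ℕ) (z : (freeChains.obj (TopCat.toSSet.obj Y)).X n)
    (hz : (freeChains.obj (TopCat.toSSet.obj Y)).d n (n - 1) z = 0)
    (w : (freeChains.obj (TopCat.toSSet.obj Q)).X (n + 1))
    (hw : (freeChains.obj (TopCat.toSSet.obj Q)).d (n + 1) n w =
      (freeChains.map (TopCat.toSSet.map q)).f n z) :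
    ∃ y, (freeChains.obj (TopCat.toSSet.obj Y)).d (n + 1) n y = z := by
  let H := freeChainsHomotopy h
  have hc := congr($(H.comm n) z)
  have h₁ : (freeChains.map (TopCat.toSSet.map (q ≫ s))).f n z =
      (freeChains.obj (TopCat.toSSet.obj Y)).d (n + 1) n
        ((freeChains.map (TopCat.toSSet.map s)).f (n + 1) w) := by
    have := congr($((freeChains.map (TopCat.toSSet.map s)).comm (n + 1) n) w)
    refine Eq.trans ?_ this.symm
    refine Eq.trans ?_ congr((freeChains.map (TopCat.toSSet.map s)).f n $hw.symm)
    rw [Functor.map_comp, Functor.map_comp]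
    rfl
  have h₂ : (freeChains.map (TopCat.toSSet.map (𝟙 Y))).f n z = z := by
    rw [CategoryTheory.Functor.map_id, CategoryTheory.Functor.map_id]
    rfl
  have h₃ : (dNext n H.hom) z = 0 := by
    cases n with
    | zero =>
      rw [dNext_eq_dFrom_fromNext, HomologicalComplex.dFrom_eq_zero _ (by simp), zero_comp]
      rfl
    | succ n =>
      rw [dNext_eq H.hom (show (ComplexShape.down ℕ).Rel (n + 1) n by simp)]
      exact (congrArg (H.hom n (n + 1)) hz).trans (map_zero _)
  rw [prevD_eq H.hom (show (ComplexShape.down ℕ).Rel (n + 1) n by simp)] at hc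
  have h₄ : (freeChains.map (TopCat.toSSet.map (q ≫ s))).f n z = (dNext n H.hom) z +
    (freeChains.obj (TopCat.toSSet.obj Y)).d (n + 1) n (H.hom n (n + 1) z) +
    (freeChains.map (TopCat.toSSet.map (𝟙 Y))).f n z := hc
  rw [h₁, h₂, h₃, zero_add] at h₄
  exact ⟨(freeChains.map (TopCat.toSSet.map s)).f (n + 1) w - H.hom n (n + 1) z, by
    rw [map_sub, h₄, add_sub_cancel_left]⟩

-- A totally disconnected space has only constant singular simplices, hence no homology in positive
-- degrees; the homotopy transports this to Y.
include h in
lemma exact_freeChains_of_homotopy_discrete [TotallyDisconnectedSpace Q] (n : ℕ) :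
    Function.Exact ((freeChains.obj (TopCat.toSSet.obj Y)).d (n + 2) (n + 1))
      ((freeChains.obj (TopCat.toSSet.obj Y)).d (n + 1) n) := by
  intro z
  refine ⟨fun hz => ?_, ?_⟩
  · have hQ := (AlgebraicTopology.singularChainComplexFunctor_exactAt_of_totallyDisconnectedSpace
      (ModuleCat.{0} ℤ) (n + 1) (ModuleCat.of ℤ ℤ) Q (by simp)).of_iso (singularChainsIso.app Q)
    rw [HomologicalComplex.exactAt_iff' _ (n + 2) (n + 1) n (by simp) (by simp),
      ShortComplex.moduleCat_exact_iff] at hQ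
    obtain ⟨w, hw⟩ := hQ ((freeChains.map (TopCat.toSSet.map q)).f (n + 1) z) (by
      refine (congr($((freeChains.map (TopCat.toSSet.map q)).comm (n + 1) n) z)).trans ?_
      exact (congrArg ((freeChains.map (TopCat.toSSet.map q)).f n) hz).trans (map_zero _))
    exact exists_d_eq_of_map_eq_d q s h (n + 1) z hz w hw
  · rintro ⟨y, rfl⟩
    exact congr($((freeChains.obj (TopCat.toSSet.obj Y)).d_comp_d (n + 2) (n + 1) n) y)

include h in
lemma exists_d_one_eq_of_map_eq_zero (z : (freeChains.obj (TopCat.toSSet.obj Y)).X 0)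
    (hz : (freeChains.map (TopCat.toSSet.map q)).f 0 z = 0) :
    ∃ y, (freeChains.obj (TopCat.toSSet.obj Y)).d 1 0 y = z :=
  -- Here n - 1 = 0 by truncated subtraction, and the cycle condition concerns the zero map from
  -- degree 0 to itself.
  exists_d_eq_of_map_eq_d q s h 0 z (by
    rw [HomologicalComplex.shape _ _ _ (by simp)]; rfl) 0 (by rw [map_zero, hz])

end HomotopyDiscrete

end

noncomputable section

open Opposite Simplicial Limits MonoidAlgebra

/-! ### Chains of a simplicial set relative to an invariant subcomplex -/

/-- A subcomplex of a simplicial set with a group action, stable under the action. -/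
structure InvariantSubcomplex (Γ : Type) [Group Γ] (X : SSet.{0}) [∀ n, MulAction Γ (X.obj n)] where
  /-- the subcomplex -/
  toSubcomplex : X.Subcomplex
  equivariant : ∀ {n m : SimplexCategoryᵒᵖ} (f : n ⟶ m) (g : Γ) (x : X.obj n),
    X.map f (g • x) = g • X.map f x
  smul_mem : ∀ {n : SimplexCategoryᵒᵖ} (g : Γ) {x : X.obj n}, x ∈ toSubcomplex.obj n →
    g • x ∈ toSubcomplex.obj n

/-- The linear extension of an equivariant map, as a map of representations. -/
def Rep.permutationMap {Γ : Type} [Group Γ] {X Y : Type} [MulAction Γ X] [MulAction Γ Y]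
    (f : X → Y) (hf : ∀ (g : Γ) (x : X), f (g • x) = g • f x) :
    Rep.ofMulAction ℤ Γ X ⟶ Rep.ofMulAction ℤ Γ Y :=
  Rep.ofHom ⟨mapDomainLinearMap ℤ ℤ f, fun g => lhom_ext' fun x => LinearMap.ext_ring <| by
    simp [hf]⟩

lemma Rep.permutationMap_single {Γ : Type} [Group Γ] {X Y : Type} [MulAction Γ X] [MulAction Γ Y]
    (f : X → Y) (hf : ∀ (g : Γ) (x : X), f (g • x) = g • f x) (x : X) (r : ℤ) :
    (Rep.permutationMap f hf).hom (single x r) = single (f x) r :=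
  mapDomainLinearMap_single _ _ _

lemma Rep.ofMulAction_hom_ext {Γ : Type} [Group Γ] {X : Type} [MulAction Γ X] {M : Rep.{0} ℤ Γ}
    {f g : Rep.ofMulAction ℤ Γ X ⟶ M} (h : ∀ x, f.hom (single x 1) = g.hom (single x 1)) :
    f = g := by
  refine Rep.hom_ext (DFunLike.ext _ _ fun z => ?_)
  rw [TruncatedComplex.eq_sum_single z, map_sum, map_sum]
  exact Finset.sum_congr rfl fun x _ => by rw [map_zsmul, map_zsmul, h]

lemma Rep.alternatingFaceMapComplex_d {Γ : Type} [Group Γ] (S : SimplicialObject (Rep.{0} ℤ Γ))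
    (n : ℕ) (w : S _⦋n + 1⦌) :
    (show S _⦋n + 1⦌ ⟶ S _⦋n⦌ from
      (AlgebraicTopology.AlternatingFaceMapComplex.obj S).d (n + 1) n).hom w =
      ∑ k : Fin (n + 2), (-1 : ℤ) ^ (k : ℕ) • (S.δ k).hom w := by
  have h : ∀ f : S _⦋n + 1⦌ ⟶ S _⦋n⦌, f = ∑ k : Fin (n + 2), (-1 : ℤ) ^ (k : ℕ) • S.δ k →
      f.hom w = ∑ k : Fin (n + 2), (-1 : ℤ) ^ (k : ℕ) • (S.δ k).hom w := by
    rintro _ rfl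
    simp only [Rep.sum_hom, Rep.zsmul_hom, Representation.IntertwiningMap.sum_apply]
    rfl
  exact h _ (AlgebraicTopology.AlternatingFaceMapComplex.obj_d_eq S n)

namespace InvariantSubcomplex

variable {Γ : Type} [Group Γ] {X : SSet.{0}} [∀ n, MulAction Γ (X.obj n)]
  (F : InvariantSubcomplex Γ X)

/-- The simplices outside of the subcomplex. -/
abbrev Complement (n : SimplexCategoryᵒᵖ) : Type := {x : X.obj n // x ∉ F.toSubcomplex.obj n}

instance (n : SimplexCategoryᵒᵖ) : MulAction Γ (F.Complement n) where
  smul g x := ⟨g • x.1, fun h => x.2 (by simpa using F.smul_mem g⁻¹ h)⟩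
  one_smul x := Subtype.ext (one_smul Γ x.1)
  mul_smul g h x := Subtype.ext (mul_smul g h x.1)

lemma coe_smul {n : SimplexCategoryᵒᵖ} (g : Γ) (x : F.Complement n) :
    ((g • x : F.Complement n) : X.obj n) = g • (x : X.obj n) := rfl

open Classical in
/-- The map of chains annihilating the subcomplex. -/
def collapse (n : SimplexCategoryᵒᵖ) :
    MonoidAlgebra ℤ (X.obj n) →ₗ[ℤ] MonoidAlgebra ℤ (F.Complement n) :=
  TruncatedComplex.partialLift (fun x => x ∉ F.toSubcomplex.obj n) fun x h => ⟨x, h⟩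

lemma collapse_of_notMem {n : SimplexCategoryᵒᵖ} {x : X.obj n} (h : x ∉ F.toSubcomplex.obj n) :
    F.collapse n (single x 1) = single ⟨x, h⟩ 1 :=
  TruncatedComplex.partialLift_single (p := fun x => x ∉ F.toSubcomplex.obj n)
    (fun x h => (⟨x, h⟩ : F.Complement n)) h

lemma collapse_of_mem {n : SimplexCategoryᵒᵖ} {x : X.obj n} (h : x ∈ F.toSubcomplex.obj n) :
    F.collapse n (single x 1) = 0 := by
  simp [collapse, TruncatedComplex.partialLift, h]

lemma collapse_coe {n : SimplexCategoryᵒᵖ} (x : F.Complement n) :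
    F.collapse n (single x.1 1) = single x 1 :=
  F.collapse_of_notMem x.2

lemma collapse_smul {n : SimplexCategoryᵒᵖ} (g : Γ) (x : X.obj n) :
    F.collapse n (single (g • x) 1) =
      Representation.ofMulAction ℤ Γ (F.Complement n) g (F.collapse n (single x 1)) := by
  by_cases h : x ∈ F.toSubcomplex.obj n
  · rw [F.collapse_of_mem h, F.collapse_of_mem (F.smul_mem g h), map_zero]
  · rw [F.collapse_of_notMem h, Representation.ofMulAction_single, ← F.collapse_coe]
    rfl

/-- The map of chains annihilating the subcomplex, as a map of representations. -/
def collapseRep (n : SimplexCategoryᵒᵖ) :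
    Rep.ofMulAction ℤ Γ (X.obj n) ⟶ Rep.ofMulAction ℤ Γ (F.Complement n) :=
  Rep.ofHom ⟨F.collapse n, fun g => lhom_ext' fun x => LinearMap.ext_ring <| by
    simp [collapse_smul]⟩

/-- The inclusion of the chains outside of the subcomplex. -/
def inclusionRep (n : SimplexCategoryᵒᵖ) :
    Rep.ofMulAction ℤ Γ (F.Complement n) ⟶ Rep.ofMulAction ℤ Γ (X.obj n) :=
  Rep.permutationMap Subtype.val fun _ _ => rfl

/-- The action of a simplicial operator on chains. -/
def operatorRep {n m : SimplexCategoryᵒᵖ} (f : n ⟶ m) :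
    Rep.ofMulAction ℤ Γ (X.obj n) ⟶ Rep.ofMulAction ℤ Γ (X.obj m) :=
  Rep.permutationMap (X.map f) (F.equivariant f)

lemma operatorRep_single {n m : SimplexCategoryᵒᵖ} (f : n ⟶ m) (x : X.obj n) :
    (F.operatorRep f).hom (single x 1) = single (X.map f x) 1 :=
  Rep.permutationMap_single _ _ _ _

lemma inclusionRep_comp_collapseRep (n : SimplexCategoryᵒᵖ) :
    F.inclusionRep n ≫ F.collapseRep n = 𝟙 _ :=
  Rep.ofMulAction_hom_ext fun x =>
    (congrArg (F.collapse n) (Rep.permutationMap_single _ _ _ _)).trans (F.collapse_coe x)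

lemma collapse_operatorRep_of_mem {n m : SimplexCategoryᵒᵖ} (f : n ⟶ m) {x : X.obj n}
    (h : x ∈ F.toSubcomplex.obj n) :
    F.collapse m ((F.operatorRep f).hom (single x 1)) = 0 := by
  rw [operatorRep_single, F.collapse_of_mem (F.toSubcomplex.map f h)]

/-- Simplicial operators preserve the subcomplex, so killing it beforehand makes no difference once
it is killed afterwards. This is what makes the relative chains functorial. -/
lemma collapseRep_comp (n m : SimplexCategoryᵒᵖ) (f : n ⟶ m) :
    F.collapseRep n ≫ F.inclusionRep n ≫ F.operatorRep f ≫ F.collapseRep m =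
      F.operatorRep f ≫ F.collapseRep m := by
  refine Rep.ofMulAction_hom_ext fun x => ?_
  change F.collapse m ((F.operatorRep f).hom ((F.inclusionRep n).hom (F.collapse n (single x 1)))) =
    F.collapse m ((F.operatorRep f).hom (single x 1))
  by_cases h : x ∈ F.toSubcomplex.obj n
  · rw [F.collapse_of_mem h, F.collapse_operatorRep_of_mem f h, map_zero, map_zero, map_zero]
  · rw [F.collapse_of_notMem h]
    exact congrArg (fun y => F.collapse m ((F.operatorRep f).hom y))
      (Rep.permutationMap_single _ _ _ _)

/-- The simplicial representation of relative chains. -/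
def relativeSimplicial : SimplicialObject (Rep.{0} ℤ Γ) where
  obj n := Rep.ofMulAction ℤ Γ (F.Complement n)
  map {n m} f := F.inclusionRep n ≫ F.operatorRep f ≫ F.collapseRep m
  map_id n := by
    have : F.operatorRep (𝟙 n) = 𝟙 _ := Rep.ofMulAction_hom_ext fun x =>
      (F.operatorRep_single _ x).trans (by simp)
    rw [this, Category.id_comp, inclusionRep_comp_collapseRep]
  map_comp {n m k} f g := by
    have : F.operatorRep (f ≫ g) = F.operatorRep f ≫ F.operatorRep g :=
      Rep.ofMulAction_hom_ext fun x => by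
        refine Eq.trans ?_ (congrArg (F.operatorRep g).hom (F.operatorRep_single f x)).symm
        rw [operatorRep_single, operatorRep_single, Functor.map_comp]
        rfl
    simp only [Category.assoc, collapseRep_comp, this]

/-- The complex of relative chains. -/
def relativeComplex : ChainComplex (Rep.{0} ℤ Γ) ℕ :=
  AlgebraicTopology.AlternatingFaceMapComplex.obj F.relativeSimplicial

/-- Modelling relative chains on the simplices outside the subcomplex, rather than as a quotient,
makes them permutation modules of a free action. -/
lemma projective_relativeComplex
    (hX : ∀ (n : SimplexCategoryᵒᵖ) (g : Γ) (x : X.obj n), g • x = x → g = 1) (n : ℕ) :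
    Projective (F.relativeComplex.X n) :=
  Rep.projective_ofMulAction fun g x h => hX _ g x.1 (congrArg Subtype.val h)

/-- The projection from chains to relative chains. -/
def projection (n : ℕ) : (freeChains.obj X).X n →ₗ[ℤ] F.relativeComplex.X n :=
  F.collapse (op ⦋n⦌)

lemma relativeSimplicial_δ {n : ℕ} (k : Fin (n + 2)) (x : X _⦋n + 1⦌) :
    (F.relativeSimplicial.δ k).hom (F.projection (n + 1) (simplexChain x)) =
      F.projection n (simplexChain (X.δ k x)) := by
  have := F.collapseRep_comp _ _ (SimplexCategory.δ k).op
  refine (congr($(this).hom (single x 1))).trans ?_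
  exact congrArg (F.collapse _) (F.operatorRep_single _ x)

lemma projection_d {n : ℕ} (z : (freeChains.obj X).X (n + 1)) :
    F.projection n ((freeChains.obj X).d (n + 1) n z) =
      (F.relativeComplex.d (n + 1) n).hom (F.projection (n + 1) z) := by
  suffices h : F.projection n ∘ₗ ((freeChains.obj X).d (n + 1) n).hom =
      (F.relativeComplex.d (n + 1) n).hom.toLinearMap ∘ₗ F.projection (n + 1) from
    LinearMap.congr_fun h z
  refine lhom_ext' fun x => LinearMap.ext_ring ?_
  change F.projection n ((freeChains.obj X).d (n + 1) n (simplexChain x)) =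
    (F.relativeComplex.d (n + 1) n).hom (F.projection (n + 1) (simplexChain x))
  rw [freeChains_d, map_sum]
  refine Eq.trans ?_ (Rep.alternatingFaceMapComplex_d F.relativeSimplicial n _).symm
  refine Finset.sum_congr rfl fun k _ => (map_zsmul (F.projection n) _ _).trans ?_
  rw [← relativeSimplicial_δ]
  rfl

lemma surjective_projection (n : ℕ) : Function.Surjective (F.projection n) := fun z =>
  ⟨(F.inclusionRep (op ⦋n⦌)).hom z, congr($(F.inclusionRep_comp_collapseRep (op ⦋n⦌)).hom z)⟩

/-- A chain minus its part outside the subcomplex (`φ`) is always a combination of simplices in the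
image of `j`. -/
lemma projection_eq_zero_iff {Y : SSet.{0}} (j : Y ⟶ X)
    (hj : ∀ n (x : X.obj n), x ∈ F.toSubcomplex.obj n ↔ ∃ y, j.app n y = x) (n : ℕ)
    (z : (freeChains.obj X).X n) :
    F.projection n z = 0 ↔ ∃ y, (freeChains.map j).f n y = z := by
  let r := LinearMap.range (mapDomainLinearMap ℤ ℤ fun y : Y _⦋n⦌ => j.app (op ⦋n⦌) y)
  let φ : MonoidAlgebra ℤ (X _⦋n⦌) →ₗ[ℤ] MonoidAlgebra ℤ (X _⦋n⦌) :=
    LinearMap.id - mapDomainLinearMap ℤ ℤ Subtype.val ∘ₗ F.collapse (op ⦋n⦌)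
  have e : ∀ x, φ (single x 1) ∈ r := fun x => by
    change single x 1 - mapDomainLinearMap ℤ ℤ Subtype.val (F.collapse _ (single x 1)) ∈ r
    by_cases hx : x ∈ F.toSubcomplex.obj (op ⦋n⦌)
    · obtain ⟨y, rfl⟩ := (hj _ x).1 hx
      rw [F.collapse_of_mem hx, map_zero, sub_zero]
      exact ⟨single y 1, mapDomainLinearMap_single _ _ _⟩
    · rw [F.collapse_of_notMem hx, mapDomainLinearMap_single, sub_self]
      exact zero_mem _
  have h : ∀ z : MonoidAlgebra ℤ (X _⦋n⦌), φ z ∈ r := fun z => by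
    rw [TruncatedComplex.eq_sum_single z, map_sum]
    refine Submodule.sum_mem _ fun x _ => ?_
    rw [map_smul]
    exact Submodule.smul_mem _ _ (e x)
  constructor
  · intro hz
    obtain ⟨y, hy⟩ := h z
    refine ⟨y, hy.trans ?_⟩
    have : φ z = (show MonoidAlgebra ℤ (X _⦋n⦌) from z) -
      mapDomainLinearMap ℤ ℤ Subtype.val (F.collapse (op ⦋n⦌) z) := rfl
    refine this.trans ?_
    rw [show F.collapse (op ⦋n⦌) z = 0 from hz, map_zero, sub_zero]
  · rintro ⟨y, rfl⟩
    suffices h : F.projection n ∘ₗ ((freeChains.map j).f n).hom = 0 from LinearMap.congr_fun h y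
    refine lhom_ext' fun y => LinearMap.ext_ring ?_
    refine (congrArg (F.projection n) (freeChains_map_f j y)).trans ?_
    exact F.collapse_of_mem ((hj _ _).2 ⟨y, rfl⟩)

/-! ### Coinvariants of relative chains and chains of the quotient -/

variable {Γ : Type} [Group Γ] {X : SSet.{0}} [∀ n, MulAction Γ (X.obj n)]
  (F : InvariantSubcomplex Γ X)

/-- The coinvariants of the complex of relative chains. -/
def coinvariantComplex : ChainComplex (ModuleCat.{0} ℤ) ℕ :=
  ((Rep.coinvariantsFunctor ℤ Γ).mapHomologicalComplex _).obj F.relativeComplex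

/-- The class of a relative chain in the coinvariants. -/
def coinvariantMk (n : ℕ) : ModuleCat.of ℤ (MonoidAlgebra ℤ (F.Complement (op ⦋n⦌))) ⟶
    F.coinvariantComplex.X n :=
  (Rep.coinvariantsMk ℤ Γ).app (F.relativeComplex.X n)

/-- The class of a simplex in the coinvariants of the relative chains. -/
def simplexClass {n : ℕ} (x : X _⦋n⦌) : F.coinvariantComplex.X n :=
  F.coinvariantMk n (F.collapse (op ⦋n⦌) (single x 1))

lemma simplexClass_smul {n : ℕ} (g : Γ) (x : X _⦋n⦌) :
    F.simplexClass (g • x) = F.simplexClass x := by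
  rw [simplexClass, collapse_smul]
  exact Representation.Coinvariants.mk_self_apply
    (Representation.ofMulAction ℤ Γ (F.Complement (op ⦋n⦌))) g _

lemma simplexClass_of_mem {n : ℕ} {x : X _⦋n⦌} (h : x ∈ F.toSubcomplex.obj (op ⦋n⦌)) :
    F.simplexClass x = 0 := by
  rw [simplexClass, F.collapse_of_mem h, map_zero]

lemma d_simplexClass {n : ℕ} (x : X _⦋n + 1⦌) :
    F.coinvariantComplex.d (n + 1) n (F.simplexClass x) =
      ∑ k : Fin (n + 2), (-1 : ℤ) ^ (k : ℕ) • F.simplexClass (X.δ k x) := by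
  have h : F.coinvariantComplex.d (n + 1) n (F.simplexClass x) =
      F.coinvariantMk n ((F.relativeComplex.d (n + 1) n).hom (F.projection (n + 1)
        (simplexChain x))) := rfl
  rw [h, ← projection_d, freeChains_d, map_sum]
  refine (map_sum (F.coinvariantMk n).hom _ _).trans ?_
  refine Finset.sum_congr rfl fun k _ => ?_
  refine (congrArg (F.coinvariantMk n).hom (map_zsmul (F.projection n) _ _)).trans ?_
  exact map_zsmul (F.coinvariantMk n).hom _ _

variable {A B : SSet.{0}} (p : X ⟶ B) (hp : ∀ n, Function.Surjective (p.app n))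
  (hpo : ∀ n (x y : X.obj n), p.app n x = p.app n y ↔ ∃ g : Γ, x = g • y) (i : A ⟶ B)
  (hF : ∀ n (x : X.obj n), x ∈ F.toSubcomplex.obj n ↔ ∃ a, i.app n a = p.app n x)

/-- The map from chains of the quotient to the coinvariants of the relative chains. -/
def quotientMap (n : ℕ) : (freeChains.obj B).X n ⟶ F.coinvariantComplex.X n :=
  ModuleCat.monoidAlgebraDesc fun b => F.simplexClass (Function.surjInv (hp (op ⦋n⦌)) b)

-- The lift of a simplex used in `quotientMap` is arbitrary; two lifts differ by a group element and
-- become equal in the coinvariants.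
include hpo in
lemma quotientMap_simplexChain {n : ℕ} (x : X _⦋n⦌) :
    F.quotientMap p hp n (simplexChain (p.app _ x)) = F.simplexClass x := by
  refine (ModuleCat.monoidAlgebraDesc_single _ _).trans ?_
  obtain ⟨g, hg⟩ := (hpo _ _ _).1 (Function.surjInv_eq (hp (op ⦋n⦌)) (p.app _ x))
  rw [hg, simplexClass_smul]

include hpo in
lemma quotientMap_comm (n : ℕ) :
    F.quotientMap p hp (n + 1) ≫ F.coinvariantComplex.d (n + 1) n =
      (freeChains.obj B).d (n + 1) n ≫ F.quotientMap p hp n := by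
  refine freeChains_hom_ext fun b => ?_
  obtain ⟨x, rfl⟩ := hp _ b
  change F.coinvariantComplex.d (n + 1) n (F.quotientMap p hp (n + 1) _) =
    F.quotientMap p hp n ((freeChains.obj B).d (n + 1) n _)
  rw [F.quotientMap_simplexChain p hp hpo, d_simplexClass, freeChains_d, map_sum]
  refine Finset.sum_congr rfl fun k _ => ?_
  rw [map_zsmul]
  have : B.δ k (p.app _ x) = p.app _ (X.δ k x) :=
    (NatTrans.naturality_apply p (SimplexCategory.δ k).op x).symm
  rw [this, F.quotientMap_simplexChain p hp hpo]

/-- The chain map from chains of the quotient to the coinvariants of the relative chains. -/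
def quotientChainMap : freeChains.obj B ⟶ F.coinvariantComplex :=
  { f := F.quotientMap p hp
    comm' := by
      rintro _ n rfl
      exact F.quotientMap_comm p hp hpo n }

include hF in
lemma map_comp_quotientChainMap : freeChains.map i ≫ F.quotientChainMap p hp hpo = 0 := by
  refine HomologicalComplex.hom_ext _ _ fun n => freeChains_hom_ext fun a => ?_
  obtain ⟨x, hx⟩ := hp _ (i.app (op ⦋n⦌) a)
  change F.quotientMap p hp n ((freeChains.map i).f n (simplexChain a)) = 0
  rw [freeChains_map_f, ← hx, F.quotientMap_simplexChain p hp hpo]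
  exact F.simplexClass_of_mem ((hF _ _).2 ⟨a, hx.symm⟩)

/-- The class in the quotient chains of a simplex outside of the subcomplex. -/
def cokernelClass {n : ℕ} (x : F.Complement (op ⦋n⦌)) : (cokernel (freeChains.map i)).X n :=
  (cokernel.π (freeChains.map i)).f n (simplexChain (p.app _ x.1))

/-- The map from the coinvariants of the relative chains to the quotient chains. -/
def fromCoinvariants (n : ℕ) :
    F.coinvariantComplex.X n ⟶ (cokernel (freeChains.map i)).X n :=
  ModuleCat.ofHom (Representation.Coinvariants.lift
    (Representation.ofMulAction ℤ Γ (F.Complement (op ⦋n⦌)))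
    (ModuleCat.monoidAlgebraDesc (F.cokernelClass p i (n := n))).hom
    fun g => by
      refine lhom_ext' fun x => LinearMap.ext_ring ?_
      change (ModuleCat.monoidAlgebraDesc (F.cokernelClass p i)).hom
        (Representation.ofMulAction ℤ Γ (F.Complement (op ⦋n⦌)) g (single x 1)) =
        (ModuleCat.monoidAlgebraDesc (F.cokernelClass p i)).hom (single x 1)
      rw [Representation.ofMulAction_single, ModuleCat.monoidAlgebraDesc_single,
        ModuleCat.monoidAlgebraDesc_single, cokernelClass, cokernelClass, F.coe_smul,
        (hpo _ _ _).2 ⟨g, rfl⟩])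

lemma fromCoinvariants_mk (n : ℕ) (x : F.Complement (op ⦋n⦌)) :
    F.fromCoinvariants p hpo i n (F.coinvariantMk n (single x 1)) = F.cokernelClass p i x :=
  ModuleCat.monoidAlgebraDesc_single _ _

include hF in
lemma fromCoinvariants_simplexClass (n : ℕ) (x : X _⦋n⦌) :
    F.fromCoinvariants p hpo i n (F.simplexClass x) =
      (cokernel.π (freeChains.map i)).f n (simplexChain (p.app _ x)) := by
  by_cases hx : x ∈ F.toSubcomplex.obj (op ⦋n⦌)
  · rw [F.simplexClass_of_mem hx, map_zero]
    obtain ⟨a, ha⟩ := (hF _ _).1 hx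
    rw [← ha, ← freeChains_map_f]
    have h := HomologicalComplex.congr_hom (cokernel.condition (freeChains.map i)) n
    exact congr($(h.symm) (simplexChain a))
  · rw [simplexClass, F.collapse_of_notMem hx, fromCoinvariants_mk]
    rfl

lemma coinvariantComplex_hom_ext {n : ℕ} {M : ModuleCat.{0} ℤ}
    {f g : F.coinvariantComplex.X n ⟶ M}
    (h : ∀ x : X _⦋n⦌, f (F.simplexClass x) = g (F.simplexClass x)) : f = g := by
  have : Epi (F.coinvariantMk n) :=
    inferInstanceAs (Epi ((Rep.coinvariantsMk ℤ Γ).app (F.relativeComplex.X n)))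
  rw [← cancel_epi (F.coinvariantMk n)]
  refine ModuleCat.hom_ext (lhom_ext' fun x => LinearMap.ext_ring ?_)
  have := h x.1
  rwa [simplexClass, F.collapse_coe] at this

include hp hpo hF in
/-- The quotient chains are the coinvariants of the relative chains. -/
lemma nonempty_cokernel_iso :
    Nonempty (cokernel (freeChains.map i) ≅ F.coinvariantComplex) := by
  let φ : cokernel (freeChains.map i) ⟶ F.coinvariantComplex :=
    cokernel.desc _ (F.quotientChainMap p hp hpo) (F.map_comp_quotientChainMap p hp hpo i hF)
  have hφ : ∀ n, (cokernel.π (freeChains.map i)).f n ≫ φ.f n = F.quotientMap p hp n := fun n =>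
    HomologicalComplex.congr_hom (cokernel.π_desc _ (F.quotientChainMap p hp hpo) _) n
  have h : ∀ n, F.quotientMap p hp n ≫ F.fromCoinvariants p hpo i n =
      (cokernel.π (freeChains.map i)).f n := fun n => freeChains_hom_ext fun b => by
    obtain ⟨x, rfl⟩ := hp _ b
    refine Eq.trans (congrArg (F.fromCoinvariants p hpo i n)
      (F.quotientMap_simplexChain p hp hpo x)) ?_
    exact F.fromCoinvariants_simplexClass p hpo i hF n x
  -- The two maps exchange the class of a simplex x of X and the class of its image `p x`, so they
  -- are inverse on generators.
  have : ∀ n, IsIso (φ.f n) := fun n => by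
    refine ⟨F.fromCoinvariants p hpo i n, ?_, ?_⟩
    · rw [← cancel_epi ((cokernel.π (freeChains.map i)).f n), reassoc_of% hφ, h, Category.comp_id]
    · refine F.coinvariantComplex_hom_ext fun x => ?_
      change φ.f n (F.fromCoinvariants p hpo i n (F.simplexClass x)) = F.simplexClass x
      rw [F.fromCoinvariants_simplexClass p hpo i hF, ← F.quotientMap_simplexChain p hp hpo, ← hφ]
      rfl
  have := HomologicalComplex.Hom.isIso_of_components φ
  exact ⟨asIso φ⟩

end InvariantSubcomplex

namespace GeometricRealization

/-! ### Singular simplices of the universal space -/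

section Singular

variable {Y Z : TopCat.{0}}

lemma toSSetObjEquiv_map (f : Y ⟶ Z) {n : SimplexCategoryᵒᵖ} (σ : (TopCat.toSSet.obj Y).obj n)
    (t : stdSimplex ℝ (Fin (n.unop.len + 1))) :
    Z.toSSetObjEquiv n ((TopCat.toSSet.map f).app n σ) t = f (Y.toSSetObjEquiv n σ t) := rfl

lemma singular_ext {n : SimplexCategoryᵒᵖ} {σ τ : (TopCat.toSSet.obj Y).obj n}
    (h : ∀ t, Y.toSSetObjEquiv n σ t = Y.toSSetObjEquiv n τ t) : σ = τ :=
  (Y.toSSetObjEquiv n).injective (ContinuousMap.ext h)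

/-- The point of a singular `0`-simplex. -/
def singularPoint (σ : (TopCat.toSSet.obj Y) _⦋0⦌) : Y :=
  Y.toSSetObjEquiv _ σ (stdSimplex.vertex (S := ℝ) (0 : Fin 1))

lemma singularPoint_map (f : Y ⟶ Z) (σ : (TopCat.toSSet.obj Y) _⦋0⦌) :
    singularPoint ((TopCat.toSSet.map f).app _ σ) = f (singularPoint σ) := rfl

lemma singularPoint_injective : Function.Injective (singularPoint (Y := Y)) := fun σ τ h =>
  singular_ext fun t => by
    have : t = stdSimplex.vertex (S := ℝ) (0 : Fin 1) := Subsingleton.elim (α := stdSimplex ℝ (Fin 1)) _ _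
    rw [this]
    exact h

lemma singularPoint_surjective (y : Y) : ∃ σ : (TopCat.toSSet.obj Y) _⦋0⦌, singularPoint σ = y :=
  ⟨(Y.toSSetObjEquiv _).symm (ContinuousMap.const _ y), by
    rw [singularPoint, Equiv.apply_symm_apply]; rfl⟩

lemma singularPoint_δ (k : Fin 2) (σ : (TopCat.toSSet.obj Y) _⦋1⦌) :
    ∃ t, singularPoint ((TopCat.toSSet.obj Y).δ k σ) = Y.toSSetObjEquiv _ σ t :=
  ⟨_, TopCat.toSSetObjEquiv_naturality_apply (SimplexCategory.δ k) σ _⟩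

end Singular

variable {Γ : Type} [Group Γ]

instance (n : SimplexCategoryᵒᵖ) : MulAction Γ ((TopCat.toSSet.obj (universalSpace Γ)).obj n) where
  smul g σ := (TopCat.toSSet.map (translate g)).app n σ
  one_smul _ := singular_ext fun _ => one_smul Γ _
  mul_smul g h _ := singular_ext fun _ => mul_smul g h _

lemma toSSetObjEquiv_smul {n : SimplexCategoryᵒᵖ} (g : Γ)
    (σ : (TopCat.toSSet.obj (universalSpace Γ)).obj n) (t : stdSimplex ℝ (Fin (n.unop.len + 1))) :
    (universalSpace Γ).toSSetObjEquiv n (g • σ) t = g • (universalSpace Γ).toSSetObjEquiv n σ t :=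
  rfl

lemma eq_one_of_smul_singular_eq (n : SimplexCategoryᵒᵖ) (g : Γ)
    (σ : (TopCat.toSSet.obj (universalSpace Γ)).obj n) (h : g • σ = σ) : g = 1 :=
  eq_one_of_smul_eq g ((universalSpace Γ).toSSetObjEquiv n σ
    (stdSimplex.vertex (S := ℝ) (0 : Fin (n.unop.len + 1)))) (by
    rw [← toSSetObjEquiv_smul, h])

lemma surjective_singular_covering (n : SimplexCategoryᵒᵖ) :
    Function.Surjective ((TopCat.toSSet.map (covering Γ)).app n) := fun σ => by
  obtain ⟨F, hF⟩ := exists_lift (TopCat.toSSetObjEquiv _ n σ)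
  refine ⟨(TopCat.toSSetObjEquiv _ n).symm F, singular_ext fun t => ?_⟩
  rw [toSSetObjEquiv_map, Equiv.apply_symm_apply]
  exact congrFun hF t

/-- Together with surjectivity this says that the singular set of the classifying space is the orbit
set of that of the universal space. -/
lemma singular_covering_eq_iff (n : SimplexCategoryᵒᵖ)
    (σ τ : (TopCat.toSSet.obj (universalSpace Γ)).obj n) :
    (TopCat.toSSet.map (covering Γ)).app n σ = (TopCat.toSSet.map (covering Γ)).app n τ ↔
      ∃ g : Γ, σ = g • τ := by
  constructor
  · intro h
    obtain ⟨g, hg⟩ := exists_smul_eq_of_covering_comp_eq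
      (F := TopCat.toSSetObjEquiv _ n σ) (F' := TopCat.toSSetObjEquiv _ n τ) (by
        funext t
        exact congr(TopCat.toSSetObjEquiv _ n $h t))
    exact ⟨g, singular_ext hg⟩
  · rintro ⟨g, rfl⟩
    exact singular_ext fun t => covering_smul g _

/-! ### The translates of the universal space of a subgroup -/

variable (H : Subgroup Γ)

/-- The set of left cosets, with the discrete topology. -/
def Cosets : Type := Γ ⧸ H

instance : TopologicalSpace (Cosets H) := ⊥

instance : DiscreteTopology (Cosets H) := ⟨rfl⟩

/-- The chosen representative of a coset. -/
def Cosets.rep (c : Cosets H) : Γ := Quotient.out (s := QuotientGroup.leftRel H) c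

/-- The coset of an element. -/
def Cosets.mk (g : Γ) : Cosets H := (g : Γ ⧸ H)

lemma Cosets.mk_eq_iff {g h : Γ} : Cosets.mk H g = Cosets.mk H h ↔ g⁻¹ * h ∈ H :=
  QuotientGroup.eq

lemma Cosets.mk_rep (c : Cosets H) : Cosets.mk H (Cosets.rep H c) = c :=
  QuotientGroup.out_eq' c

/-- The disjoint union of copies of the universal space of a subgroup indexed by its cosets. -/
def cosetSpace : TopCat.{0} := TopCat.of (Cosets H × universalSpace H)

/-- The identification of the disjoint union with the translates of the universal space of the
subgroup. -/
def cosetSpaceMap : cosetSpace H ⟶ universalSpace Γ :=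
  TopCat.ofHom ⟨fun y : Cosets H × universalSpace H =>
      Cosets.rep H y.1 • universalInclusion H y.2,
    continuous_prod_of_discrete_left.2 fun c =>
      ((universalInclusion H).hom.continuous).const_smul (Cosets.rep H c)⟩

lemma cosetSpaceMap_mk (c : Cosets H) (y : universalSpace H) :
    cosetSpaceMap H (c, y) = Cosets.rep H c • universalInclusion H y := rfl

/-- The coset of the label of a point. -/
def cosetLabel (p : universalSpace Γ) : Cosets H := Cosets.mk H (label p)

/-- Points coming from the universal space of H have labels in H, so the label of a point of a
translate determines which translate it is; in particular distinct translates are disjoint. -/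
lemma cosetLabel_cosetSpaceMap (c : Cosets H) (y : universalSpace H) :
    cosetLabel H (cosetSpaceMap H (c, y)) = c := by
  rw [cosetSpaceMap_mk, cosetLabel, label_smul, label_universalInclusion]
  refine Eq.trans ?_ (Cosets.mk_rep H c)
  rw [Cosets.mk_eq_iff]
  simp

lemma injective_cosetSpaceMap : Function.Injective (cosetSpaceMap H) := by
  rintro ⟨c, y⟩ ⟨c', y'⟩ h
  have hc := congrArg (cosetLabel H) h
  rw [cosetLabel_cosetSpaceMap, cosetLabel_cosetSpaceMap] at hc
  subst hc
  rw [cosetSpaceMap_mk, cosetSpaceMap_mk] at h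
  rw [injective_universalInclusion H (MulAction.injective (Cosets.rep H c) h)]

lemma exists_cosetSpaceMap_eq (g : Γ) (c : Cosets H) :
    ∃ h : H, ∀ y, g • cosetSpaceMap H (c, y) =
      cosetSpaceMap H (Cosets.mk H (g * Cosets.rep H c), h • y) := by
  have hm : (Cosets.rep H (Cosets.mk H (g * Cosets.rep H c)))⁻¹ * (g * Cosets.rep H c) ∈ H := by
    rw [← Cosets.mk_eq_iff, Cosets.mk_rep]
  refine ⟨⟨_, hm⟩, fun y => ?_⟩
  rw [cosetSpaceMap_mk, cosetSpaceMap_mk, universalInclusion_smul, ← mul_smul, ← mul_smul]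
  simp

lemma continuous_cosetSection (c : Cosets H) (h : H) : Continuous fun y : universalSpace H =>
    ((c, h • y) : Cosets H × universalSpace H) :=
  continuous_const.prodMk (continuous_const_smul h)

lemma exists_cosetSpace_map (g : Γ) :
    ∃ m : cosetSpace H ⟶ cosetSpace H, m ≫ cosetSpaceMap H = cosetSpaceMap H ≫ translate g := by
  choose h hh using exists_cosetSpaceMap_eq H g
  refine ⟨TopCat.ofHom ⟨fun y : Cosets H × universalSpace H =>
    (Cosets.mk H (g * Cosets.rep H y.1), h y.1 • y.2), ?_⟩, ?_⟩
  · exact continuous_prod_of_discrete_left.2 fun c =>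
      continuous_cosetSection H (Cosets.mk H (g * Cosets.rep H c)) (h c)
  · ext ⟨c, y⟩
    exact (hh c y).symm

/-- The singular simplices in the translates of the universal space of a subgroup. -/
def translates : InvariantSubcomplex Γ (TopCat.toSSet.obj (universalSpace Γ)) where
  toSubcomplex := Subfunctor.range (TopCat.toSSet.map (cosetSpaceMap H))
  equivariant f g x := (NatTrans.naturality_apply (TopCat.toSSet.map (translate g)) f x).symm
  smul_mem := by
    rintro n g _ ⟨τ, rfl⟩
    obtain ⟨m, hm⟩ := exists_cosetSpace_map H g
    exact ⟨(TopCat.toSSet.map m).app n τ, singular_ext fun t => congr($hm _)⟩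

lemma mem_translates_iff (n : SimplexCategoryᵒᵖ)
    (σ : (TopCat.toSSet.obj (universalSpace Γ)).obj n) :
    σ ∈ (translates H).toSubcomplex.obj n ↔
      ∃ τ, (TopCat.toSSet.map (cosetSpaceMap H)).app n τ = σ := Iff.rfl

lemma covering_cosetSpaceMap (c : Cosets H) (y : universalSpace H) :
    covering Γ (cosetSpaceMap H (c, y)) =
      TruncatedComplex.classifyingSpaceInclusion Γ H (covering H y) := by
  rw [cosetSpaceMap_mk, covering_smul]
  exact congr($(covering_universalInclusion H) y)

lemma universalInclusion_mem_translates (n : SimplexCategoryᵒᵖ)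
    (τ : (TopCat.toSSet.obj (universalSpace H)).obj n) :
    (TopCat.toSSet.map (universalInclusion H)).app n τ ∈ (translates H).toSubcomplex.obj n := by
  -- The chosen representative of the trivial coset lies in H but need not be 1, so it is
  -- compensated inside the universal space of H.
  have h : (Cosets.rep H (Cosets.mk H 1))⁻¹ ∈ H := by
    rw [← mul_one (Cosets.rep H (Cosets.mk H 1))⁻¹, ← Cosets.mk_eq_iff, Cosets.mk_rep]
  let m : universalSpace H ⟶ cosetSpace H := TopCat.ofHom ⟨fun y : universalSpace H =>
    ((Cosets.mk H 1, (⟨_, h⟩ : H) • y) : Cosets H × universalSpace H),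
    continuous_cosetSection H _ _⟩
  refine ⟨(TopCat.toSSet.map m).app n τ, singular_ext fun t => ?_⟩
  refine (cosetSpaceMap_mk H _ _).trans ?_
  rw [universalInclusion_smul, ← mul_smul, mul_inv_cancel, one_smul]
  rfl

/-- The translates are the full preimage of the simplices of BH: such a simplex lifts to EH, and
every other lift in EΓ is a Γ-translate of that one. -/
lemma mem_translates_iff_covering (n : SimplexCategoryᵒᵖ)
    (σ : (TopCat.toSSet.obj (universalSpace Γ)).obj n) :
    σ ∈ (translates H).toSubcomplex.obj n ↔
      ∃ a, (TopCat.toSSet.map (TruncatedComplex.classifyingSpaceInclusion Γ H)).app n a =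
        (TopCat.toSSet.map (covering Γ)).app n σ := by
  constructor
  · rintro ⟨τ, rfl⟩
    let m : cosetSpace H ⟶ universalSpace H := TopCat.ofHom
      ⟨fun y : Cosets H × universalSpace H => y.2, continuous_snd⟩
    refine ⟨(TopCat.toSSet.map (m ≫ covering H)).app n τ, singular_ext fun t => ?_⟩
    exact (covering_cosetSpaceMap H _ _).symm
  · rintro ⟨a, ha⟩
    obtain ⟨τ, rfl⟩ := surjective_singular_covering n a
    have h : (TopCat.toSSet.map (covering Γ)).app n σ =
        (TopCat.toSSet.map (covering Γ)).app n
          ((TopCat.toSSet.map (universalInclusion H)).app n τ) :=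
      ha.symm.trans (singular_ext fun t => congr($((covering_universalInclusion H).symm) _))
    obtain ⟨g, rfl⟩ := (singular_covering_eq_iff _ _ _).1 h
    exact (translates H).smul_mem g (universalInclusion_mem_translates H n τ)

lemma nonempty_relativeChains_iso :
    Nonempty (TruncatedComplex.relativeChains Γ H ≅ (translates H).coinvariantComplex) := by
  obtain ⟨e⟩ := (translates H).nonempty_cokernel_iso (TopCat.toSSet.map (covering Γ))
    surjective_singular_covering singular_covering_eq_iff
    (TopCat.toSSet.map (TruncatedComplex.classifyingSpaceInclusion Γ H))
    (mem_translates_iff_covering H)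
  exact ⟨cokernel.mapIso _ _ (singularChainsIso.app _) (singularChainsIso.app _)
    (singularChainsIso.hom.naturality _) ≪≫ e⟩

/-! ### Exactness of the relative chains -/

variable {Γ : Type} [Group Γ]

variable (Γ) in
/-- The contraction of the universal space. -/
def universalHomotopy : TopCat.Homotopy
    ((TopCat.ofHom (ContinuousMap.const _ PUnit.unit) : universalSpace Γ ⟶ TopCat.of PUnit) ≫
      TopCat.ofHom (ContinuousMap.const _ (vertexPoint (1 : Γ) : universalSpace Γ)))
    (𝟙 (universalSpace Γ)) :=
  contractionHomotopy (1 : Γ)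

variable (Γ) in
/-- The singular chains of the universal space. -/
abbrev universalChains : ChainComplex (ModuleCat.{0} ℤ) ℕ :=
  freeChains.obj (TopCat.toSSet.obj (universalSpace Γ))

lemma exact_universalChains (n : ℕ) : Function.Exact ((universalChains Γ).d (n + 2) (n + 1))
    ((universalChains Γ).d (n + 1) n) :=
  exact_freeChains_of_homotopy_discrete _ _ (universalHomotopy Γ) n

variable (H : Subgroup Γ)

/-- The projection of the translates of the universal space of a subgroup to the cosets. -/
def toCosets : cosetSpace H ⟶ TopCat.of (Cosets H) :=
  TopCat.ofHom ⟨fun y : Cosets H × universalSpace H => y.1, continuous_fst⟩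

/-- A section of `toCosets`. -/
def cosetSection : TopCat.of (Cosets H) ⟶ cosetSpace H :=
  TopCat.ofHom ⟨fun c => ((c, vertexPoint (1 : H)) : Cosets H × universalSpace H),
    continuous_id.prodMk continuous_const⟩

/-- The deformation of the translates of the universal space of a subgroup to the cosets. -/
def cosetHomotopy : TopCat.Homotopy (toCosets H ≫ cosetSection H) (𝟙 (cosetSpace H)) where
  toFun p := ((p.2.1, contractionHomotopy (1 : H) (p.1, p.2.2)) : Cosets H × universalSpace H)
  continuous_toFun := by
    refine (continuous_fst.comp continuous_snd).prodMk ?_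
    exact (contractionHomotopy (1 : H)).continuous.comp
      (continuous_fst.prodMk (continuous_snd.comp continuous_snd))
  map_zero_left p := Prod.ext rfl ((contractionHomotopy (1 : H)).map_zero_left p.2)
  map_one_left p := Prod.ext rfl ((contractionHomotopy (1 : H)).map_one_left p.2)

/-- The singular chains of the translates of the universal space of a subgroup. -/
abbrev cosetChains : ChainComplex (ModuleCat.{0} ℤ) ℕ :=
  freeChains.obj (TopCat.toSSet.obj (cosetSpace H))

lemma exact_cosetChains (n : ℕ) : Function.Exact ((cosetChains H).d (n + 2) (n + 1))
    ((cosetChains H).d (n + 1) n) :=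
  have : TotallyDisconnectedSpace (TopCat.of (Cosets H)) :=
    inferInstanceAs (TotallyDisconnectedSpace (Cosets H))
  exact_freeChains_of_homotopy_discrete _ _ (cosetHomotopy H) n

/-- The chain map induced by the inclusion of the translates. -/
abbrev cosetChainsMap : cosetChains H ⟶ universalChains Γ :=
  freeChains.map (TopCat.toSSet.map (cosetSpaceMap H))

/-- The coset of a singular vertex. -/
def vertexCoset (σ : (TopCat.toSSet.obj (universalSpace Γ)) _⦋0⦌) : Cosets H :=
  cosetLabel H (singularPoint σ)

/-- The sum of the cosets of a `0`-chain. -/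
def labelSum : (universalChains Γ).X 0 →ₗ[ℤ] MonoidAlgebra ℤ (Cosets H) :=
  mapDomainLinearMap ℤ ℤ (vertexCoset H)

lemma labelSum_simplexChain (σ : (TopCat.toSSet.obj (universalSpace Γ)) _⦋0⦌) :
    labelSum H (simplexChain σ) = single (vertexCoset H σ) 1 :=
  mapDomainLinearMap_single _ _ _

/-- EΓ deforms to a point, where a 0-chain is seen only through its total coefficient; the latter
can be read off from the sum of the coset labels. -/
lemma exists_d_eq_of_augmentation_eq_zero (z : (universalChains Γ).X 0)
    (hz : mapDomainLinearMap ℤ ℤ (fun _ => PUnit.unit.{1}) (labelSum H z) = 0) :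
    ∃ y, (universalChains Γ).d 1 0 y = z := by
  refine exists_d_one_eq_of_map_eq_zero _ _ (universalHomotopy Γ) z ?_
  obtain ⟨τ, -⟩ := singularPoint_surjective (Y := TopCat.of PUnit) PUnit.unit
  refine Eq.trans ?_ ((congrArg (mapDomainLinearMap ℤ ℤ fun _ => τ) hz).trans (map_zero _))
  refine LinearMap.congr_fun (f := ((freeChains.map (TopCat.toSSet.map _)).f 0).hom)
    (g := mapDomainLinearMap ℤ ℤ (fun _ => τ) ∘ₗ mapDomainLinearMap ℤ ℤ (fun _ => PUnit.unit) ∘ₗ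
      labelSum H) (lhom_ext' fun σ => LinearMap.ext_ring ?_) z
  refine (freeChains_map_f _ σ).trans ?_
  change _ = mapDomainLinearMap ℤ ℤ (fun _ => τ) (mapDomainLinearMap ℤ ℤ (fun _ => PUnit.unit)
    (labelSum H (simplexChain σ)))
  rw [labelSum_simplexChain, mapDomainLinearMap_single, mapDomainLinearMap_single]
  exact congrArg (fun x => single x 1) (singularPoint_injective (Subsingleton.elim _ _))

/-- The union of translates deforms onto the discrete set of cosets, and `labelSum` computes the
image of a 0-chain there. -/
lemma exists_d_eq_of_labelSum_eq_zero (z : (cosetChains H).X 0)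
    (hz : labelSum H ((cosetChainsMap H).f 0 z) = 0) : ∃ y, (cosetChains H).d 1 0 y = z := by
  refine exists_d_one_eq_of_map_eq_zero _ _ (cosetHomotopy H) z ?_
  have h : mapDomainLinearMap ℤ ℤ (singularPoint (Y := TopCat.of (Cosets H))) ∘ₗ
      ((freeChains.map (TopCat.toSSet.map (toCosets H))).f 0).hom =
      labelSum H ∘ₗ ((cosetChainsMap H).f 0).hom := by
    refine lhom_ext' fun σ => LinearMap.ext_ring ?_
    refine (congrArg (mapDomainLinearMap ℤ ℤ _) (freeChains_map_f _ σ)).trans ?_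
    refine Eq.trans ?_ (congrArg (labelSum H) (freeChains_map_f _ σ)).symm
    rw [labelSum_simplexChain]
    refine (mapDomainLinearMap_single _ _ _).trans ?_
    exact congrArg (fun x => single x 1) (cosetLabel_cosetSpaceMap H _ _).symm
  refine mapDomain_injective (singularPoint_injective (Y := TopCat.of (Cosets H))) ?_
  refine ((LinearMap.congr_fun h z).trans hz).trans ?_
  exact (map_zero (mapDomainLinearMap ℤ ℤ (singularPoint (Y := TopCat.of (Cosets H))))).symm

lemma d_one_simplexChain {Y : SSet.{0}} (σ : Y _⦋1⦌) :
    (freeChains.obj Y).d 1 0 (simplexChain σ) =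
      simplexChain (Y.δ 0 σ) - simplexChain (Y.δ 1 σ) := by
  rw [freeChains_d, Fin.sum_univ_two]
  simp [sub_eq_add_neg]

lemma labelSum_d_simplexChain (σ : (TopCat.toSSet.obj (universalSpace Γ)) _⦋1⦌) :
    labelSum H ((universalChains Γ).d 1 0 (simplexChain σ)) =
      single (vertexCoset H ((TopCat.toSSet.obj (universalSpace Γ)).δ 0 σ)) 1 -
        single (vertexCoset H ((TopCat.toSSet.obj (universalSpace Γ)).δ 1 σ)) 1 := by
  rw [d_one_simplexChain, map_sub, labelSum_simplexChain, labelSum_simplexChain]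

/-- On the union of translates the coset label is the projection to a discrete factor, so it is
constant along a path. Hence the difference of end cosets descends to relative chains. -/
lemma vertexCoset_δ_of_mem {σ : (TopCat.toSSet.obj (universalSpace Γ)) _⦋1⦌}
    (hσ : σ ∈ (translates H).toSubcomplex.obj (op ⦋1⦌)) :
    vertexCoset H ((TopCat.toSSet.obj (universalSpace Γ)).δ 0 σ) =
      vertexCoset H ((TopCat.toSSet.obj (universalSpace Γ)).δ 1 σ) := by
  obtain ⟨τ, rfl⟩ := hσ
  obtain ⟨s, hs⟩ := singularPoint_δ 0 ((TopCat.toSSet.map (cosetSpaceMap H)).app (op ⦋1⦌) τ)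
  obtain ⟨t, ht⟩ := singularPoint_δ 1 ((TopCat.toSSet.map (cosetSpaceMap H)).app (op ⦋1⦌) τ)
  refine (congrArg (cosetLabel H) hs).trans (Eq.trans ?_ (congrArg (cosetLabel H) ht).symm)
  refine (cosetLabel_cosetSpaceMap H _ _).trans (Eq.trans ?_ (cosetLabel_cosetSpaceMap H _ _).symm)
  have hc : Continuous fun r : stdSimplex ℝ (Fin (1 + 1)) =>
      toCosets H (TopCat.toSSetObjEquiv _ (op ⦋1⦌) τ r) :=
    (toCosets H).hom.continuous.comp (map_continuous (TopCat.toSSetObjEquiv _ (op ⦋1⦌) τ))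
  exact PreconnectedSpace.constant inferInstance hc (x := s) (y := t)

/-! ### Diagram chases for the pair of EΓ and the translates of EH -/

variable {Γ : Type} [Group Γ] (H : Subgroup Γ)

/-- The chains of the universal space relative to the translates of the universal space of a
subgroup. -/
abbrev relativeUniversalChains : ChainComplex (Rep.{0} ℤ Γ) ℕ := (translates H).relativeComplex

lemma projection_eq_zero_iff (n : ℕ) (z : (universalChains Γ).X n) :
    (translates H).projection n z = 0 ↔ ∃ y, (cosetChainsMap H).f n y = z :=
  (translates H).projection_eq_zero_iff _ (mem_translates_iff H) n z

lemma injective_cosetChainsMap (n : ℕ) : Function.Injective ((cosetChainsMap H).f n) :=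
  mapDomain_injective fun _ _ h => singular_ext fun _ =>
    injective_cosetSpaceMap H congr(TopCat.toSSetObjEquiv _ _ $h _)

lemma cosetChainsMap_d (n : ℕ) (z : (cosetChains H).X (n + 1)) :
    (cosetChainsMap H).f n ((cosetChains H).d (n + 1) n z) =
      (universalChains Γ).d (n + 1) n ((cosetChainsMap H).f (n + 1) z) :=
  congr($((cosetChainsMap H).comm (n + 1) n) z).symm

lemma exists_cosetChainsMap_eq_d {n : ℕ} (a : (universalChains Γ).X (n + 1))
    (h : ((relativeUniversalChains H).d (n + 1) n).hom ((translates H).projection (n + 1) a) = 0) :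
    ∃ b, (cosetChainsMap H).f n b = (universalChains Γ).d (n + 1) n a := by
  rw [← InvariantSubcomplex.projection_d] at h
  exact (projection_eq_zero_iff H n _).1 h

/-- a minus the image of b is a cycle in the contractible space, hence a boundary, and it has the
same projection as a. -/
lemma exists_d_eq_projection {n : ℕ} (a : (universalChains Γ).X (n + 1))
    (b : (cosetChains H).X (n + 1)) (h : (cosetChainsMap H).f n ((cosetChains H).d (n + 1) n b) =
      (universalChains Γ).d (n + 1) n a) :
    ∃ c, ((relativeUniversalChains H).d (n + 2) (n + 1)).hom c =
      (translates H).projection (n + 1) a := by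
  obtain ⟨c, hc⟩ := (exact_universalChains n (a - (cosetChainsMap H).f (n + 1) b)).1 (by
    rw [map_sub, ← cosetChainsMap_d, h, sub_self])
  refine ⟨(translates H).projection (n + 2) c, ?_⟩
  rw [← InvariantSubcomplex.projection_d, hc, map_sub,
    (projection_eq_zero_iff H (n + 1) _).2 ⟨b, rfl⟩, sub_zero]

lemma exists_relative_d_eq (n : ℕ) (x : (relativeUniversalChains H).X (n + 2))
    (hx : ((relativeUniversalChains H).d (n + 2) (n + 1)).hom x = 0) :
    ∃ y, ((relativeUniversalChains H).d (n + 3) (n + 2)).hom y = x := by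
  obtain ⟨a, rfl⟩ := (translates H).surjective_projection (n + 2) x
  obtain ⟨b, hb⟩ := exists_cosetChainsMap_eq_d H a hx
  obtain ⟨b', rfl⟩ := (exact_cosetChains H n b).1 (injective_cosetChainsMap H n (by
    rw [cosetChainsMap_d, hb, map_zero]
    exact congr($((universalChains Γ).d_comp_d (n + 2) (n + 1) n) a)))
  exact exists_d_eq_projection H a b' hb

/-- The boundary of a relative 1-cycle comes from a 0-chain on the translates, which bounds there
once its coset sum vanishes; `hl` is exactly this condition. -/
lemma exists_relative_d_eq_one (a : (universalChains Γ).X 1)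
    (ha : ((relativeUniversalChains H).d 1 0).hom ((translates H).projection 1 a) = 0)
    (hl : labelSum H ((universalChains Γ).d 1 0 a) = 0) :
    ∃ y, ((relativeUniversalChains H).d 2 1).hom y = (translates H).projection 1 a := by
  obtain ⟨b, hb⟩ := exists_cosetChainsMap_eq_d H a ha
  obtain ⟨b', rfl⟩ := exists_d_eq_of_labelSum_eq_zero H b (by rw [hb, hl])
  exact exists_d_eq_projection H a b' hb

lemma exists_cosetChainsMap_labelSum_eq (k : MonoidAlgebra ℤ (Cosets H)) :
    ∃ b, labelSum H ((cosetChainsMap H).f 0 b) = k := by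
  have h : ∀ c : Cosets H, ∃ b : (cosetChains H).X 0,
      labelSum H ((cosetChainsMap H).f 0 b) = single c 1 := fun c => by
    obtain ⟨σ, hσ⟩ := singularPoint_surjective
      (Y := cosetSpace H) ((c, vertexPoint (1 : H)) : Cosets H × universalSpace H)
    refine ⟨simplexChain σ, ?_⟩
    rw [freeChains_map_f, labelSum_simplexChain, vertexCoset, singularPoint_map, hσ]
    exact congrArg (fun x => single x 1) (cosetLabel_cosetSpaceMap H _ _)
  choose f hf using h
  refine ⟨(ModuleCat.monoidAlgebraDesc f).hom k, ?_⟩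
  refine LinearMap.congr_fun (f := labelSum H ∘ₗ ((cosetChainsMap H).f 0).hom ∘ₗ
    (ModuleCat.monoidAlgebraDesc f).hom) (g := LinearMap.id)
    (lhom_ext' fun c => LinearMap.ext_ring ?_) k
  refine Eq.trans ?_ (hf c)
  exact congrArg (fun x => labelSum H ((cosetChainsMap H).f 0 x))
    (ModuleCat.monoidAlgebraDesc_single f c)

/-- A 0-chain lifting x may be changed by chains on the translates until its coset sum is k. Its
total coefficient is then 0, so it bounds in EΓ, and the correction disappears in the relative
chains. -/
lemma exists_relative_d_eq_zero (x : (relativeUniversalChains H).X 0)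
    (k : MonoidAlgebra ℤ (Cosets H))
    (hk : mapDomainLinearMap ℤ ℤ (fun _ => PUnit.unit.{1}) k = 0) :
    ∃ a, ((relativeUniversalChains H).d 1 0).hom ((translates H).projection 1 a) = x ∧
      labelSum H ((universalChains Γ).d 1 0 a) = k := by
  obtain ⟨z, rfl⟩ := (translates H).surjective_projection 0 x
  obtain ⟨b, hb⟩ := exists_cosetChainsMap_labelSum_eq H (k - labelSum H z)
  have hl : labelSum H (z + (cosetChainsMap H).f 0 b) = k := by
    rw [map_add, hb, add_sub_cancel]
  obtain ⟨a, ha⟩ := exists_d_eq_of_augmentation_eq_zero H (z + (cosetChainsMap H).f 0 b)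
    (by rw [hl, hk])
  refine ⟨a, ?_, by rw [ha, hl]⟩
  rw [← InvariantSubcomplex.projection_d, ha, map_add,
    (projection_eq_zero_iff H 0 _).2 ⟨b, rfl⟩, add_zero]

lemma vertexCoset_smul (g : Γ) (σ : (TopCat.toSSet.obj (universalSpace Γ)) _⦋0⦌) :
    vertexCoset H (g • σ) = Cosets.mk H (g * label (singularPoint σ)) :=
  congrArg (Cosets.mk H) (label_smul g (singularPoint σ))

end GeometricRealization

/-! ### Comparison of resolutions -/

namespace TruncatedComplex

open GeometricRealization

/-- The coset at a vertex of a relative singular `1`-simplex. -/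
def relativeVertex (k : Fin 2) (σ : (translates P).Complement (op ⦋1⦌)) : G ⧸ P :=
  vertexCoset P ((TopCat.toSSet.obj (universalSpace G)).δ k σ.1)

lemma relativeVertex_smul (k : Fin 2) (g : G) (σ : (translates P).Complement (op ⦋1⦌)) :
    relativeVertex k (g • σ) = g • relativeVertex k σ := by
  have h : (TopCat.toSSet.obj (universalSpace G)).δ k (g • σ.1) =
      g • (TopCat.toSSet.obj (universalSpace G)).δ k σ.1 :=
    (translates P).equivariant (SimplexCategory.δ k).op g σ.1
  change vertexCoset P ((TopCat.toSSet.obj (universalSpace G)).δ k (g • σ.1)) = _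
  rw [h, vertexCoset_smul]
  rfl

/-- The difference of the cosets at the vertices of relative singular `1`-simplices. -/
def relativeEdgeMap : Rep.ofMulAction ℤ G ((translates P).Complement (op ⦋1⦌)) ⟶ cosetChains :=
  mapRep (relativeVertex 0) (relativeVertex_smul 0) -
    mapRep (relativeVertex 1) (relativeVertex_smul 1)

lemma relativeEdgeMap_single (σ : (translates P).Complement (op ⦋1⦌)) (r : ℤ) :
    relativeEdgeMap.hom (single σ r) =
      single (relativeVertex 0 σ) r - single (relativeVertex 1 σ) r :=
  congrArg₂ (· - ·) (mapRep_single (relativeVertex 0) (relativeVertex_smul 0) σ r)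
    (mapRep_single (relativeVertex 1) (relativeVertex_smul 1) σ r)

/-- On simplices of the translates both sides vanish, the two end cosets being equal there; on the
others they agree by construction. -/
lemma relativeEdgeMap_projection (a : (universalChains G).X 1) :
    relativeEdgeMap.hom ((translates P).projection 1 a) =
      labelSum P ((universalChains G).d 1 0 a) := by
  refine LinearMap.congr_fun (f := relativeEdgeMap.hom.toLinearMap ∘ₗ (translates P).projection 1)
    (g := labelSum P ∘ₗ ((universalChains G).d 1 0).hom)
    (lhom_ext' fun σ => LinearMap.ext_ring ?_) a
  refine Eq.trans ?_ (labelSum_d_simplexChain P σ).symm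
  change relativeEdgeMap.hom ((translates P).collapse (op ⦋1⦌) (single σ 1)) = _
  by_cases hσ : σ ∈ (translates P).toSubcomplex.obj (op ⦋1⦌)
  · rw [(translates P).collapse_of_mem hσ, map_zero, vertexCoset_δ_of_mem P hσ, sub_self]
    rfl
  · rw [(translates P).collapse_of_notMem hσ, relativeEdgeMap_single]
    rfl

lemma augmentation_relativeEdgeMap (x : (relativeUniversalChains P).X 1) :
    augmentation.hom (relativeEdgeMap.hom x) = 0 := by
  have h : augmentation.hom.toLinearMap ∘ₗ relativeEdgeMap.hom.toLinearMap = 0 := by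
    refine lhom_ext' fun α => LinearMap.ext_ring ?_
    change augmentation.hom (relativeEdgeMap.hom (single α 1)) = 0
    rw [relativeEdgeMap_single, map_sub, augmentation_single, augmentation_single, sub_self]
  exact LinearMap.congr_fun h x

/-- The augmentation of the relative singular chains. -/
def relativeToK : (relativeUniversalChains P).X 1 ⟶ K :=
  Rep.ofHom (ρ := ((relativeUniversalChains P).X 1).ρ)
    ⟨relativeEdgeMap.hom.toLinearMap.codRestrict _ augmentation_relativeEdgeMap, fun g => by
      refine LinearMap.ext fun x => Subtype.ext ?_
      exact Rep.hom_comm_apply relativeEdgeMap g x⟩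

lemma mapDomain_unit_of_augmentation_eq_zero (k : MonoidAlgebra ℤ (G ⧸ P))
    (hk : augmentation.hom k = 0) :
    mapDomainLinearMap ℤ ℤ (fun _ : G ⧸ P => PUnit.unit.{1}) k = 0 := by
  have h : mapDomainLinearMap ℤ ℤ (fun _ : G ⧸ P => PUnit.unit.{1}) =
      LinearMap.toSpanSingleton ℤ (MonoidAlgebra ℤ PUnit.{1}) (single PUnit.unit 1) ∘ₗ
        augmentation.hom.toLinearMap := by
    refine lhom_ext' fun x => LinearMap.ext_ring ?_
    refine (mapDomainLinearMap_single _ _ _).trans ?_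
    refine Eq.trans ?_ (congrArg (fun r : ℤ => r • (single PUnit.unit 1 : MonoidAlgebra ℤ PUnit.{1}))
      (augmentation_single x 1)).symm
    exact (one_smul _ _).symm
  refine (LinearMap.congr_fun h k).trans ?_
  exact (congrArg (LinearMap.toSpanSingleton ℤ (MonoidAlgebra ℤ PUnit.{1}) (single PUnit.unit 1))
    hk).trans (map_zero _)

end TruncatedComplex

lemma Rep.shortComplex_exact {k Γ : Type} [CommRing k] [Group Γ] {A B C : Rep.{0} k Γ} (f : A ⟶ B) (g : B ⟶ C)
    (w : f ≫ g = 0) (h : ∀ x, g.hom x = 0 → ∃ y, f.hom y = x) : (ShortComplex.mk f g w).Exact := by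
  exact (forget₂ (Rep.{0} k Γ) (ModuleCat.{0} k)).reflects_exact_of_faithful _
    ((ShortComplex.moduleCat_exact_iff _).2 h)

lemma Rep.biprod_ext {Γ : Type} [Group Γ] {A B : Rep.{0} ℤ Γ} {x y : (A ⊞ B : Rep.{0} ℤ Γ)}
    (h₁ : (biprod.fst : A ⊞ B ⟶ A).hom x = (biprod.fst : A ⊞ B ⟶ A).hom y)
    (h₂ : (biprod.snd : A ⊞ B ⟶ B).hom x = (biprod.snd : A ⊞ B ⟶ B).hom y) : x = y := by
  have h : ∀ z : (A ⊞ B : Rep.{0} ℤ Γ), z = (biprod.inl : A ⟶ A ⊞ B).hom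
      ((biprod.fst : A ⊞ B ⟶ A).hom z) + (biprod.inr : B ⟶ A ⊞ B).hom
        ((biprod.snd : A ⊞ B ⟶ B).hom z) := fun z =>
    congr($((biprod.total (X := A) (Y := B)).symm).hom z)
  rw [h x, h y, h₁, h₂]

namespace TruncatedComplex

open GeometricRealization

lemma lift_relativeToK_eq_zero_iff (x : (relativeUniversalChains P).X 1) :
    (biprod.lift ((relativeUniversalChains P).d 1 0) relativeToK).hom x = 0 ↔
      ((relativeUniversalChains P).d 1 0).hom x = 0 ∧ relativeToK.hom x = 0 := by
  have h₁ : ∀ x, (biprod.fst : _ ⊞ K ⟶ _).hom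
      ((biprod.lift ((relativeUniversalChains P).d 1 0) relativeToK).hom x) =
      ((relativeUniversalChains P).d 1 0).hom x := fun x =>
    congr($(biprod.lift_fst ((relativeUniversalChains P).d 1 0) relativeToK).hom x)
  have h₂ : ∀ x, (biprod.snd : _ ⊞ K ⟶ _).hom
      ((biprod.lift ((relativeUniversalChains P).d 1 0) relativeToK).hom x) =
      relativeToK.hom x := fun x =>
    congr($(biprod.lift_snd ((relativeUniversalChains P).d 1 0) relativeToK).hom x)
  constructor
  · intro h
    rw [← h₁, ← h₂, h, map_zero, map_zero]
    exact ⟨rfl, rfl⟩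
  · rintro ⟨h, h'⟩
    refine Rep.biprod_ext ?_ ?_
    · rw [h₁, h, map_zero]
    · rw [h₂, h', map_zero]

lemma exists_relative_eq (x : (relativeUniversalChains P).X 0) (k : K) :
    ∃ y, ((relativeUniversalChains P).d 1 0).hom y = x ∧ relativeToK.hom y = k := by
  obtain ⟨a, ha, hk⟩ := exists_relative_d_eq_zero P x k.1
    (mapDomain_unit_of_augmentation_eq_zero k.1 k.2)
  exact ⟨_, ha, Subtype.ext ((relativeEdgeMap_projection a).trans hk)⟩

instance : Epi (biprod.lift ((relativeUniversalChains P).d 1 0) relativeToK) := by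
  refine (Rep.epi_iff_surjective _).2 fun y => ?_
  obtain ⟨x, h₁, h₂⟩ := exists_relative_eq ((biprod.fst : _ ⊞ K ⟶ _).hom y)
    ((biprod.snd : _ ⊞ K ⟶ _).hom y)
  refine ⟨x, Rep.biprod_ext ?_ ?_⟩
  · exact (congr($(biprod.lift_fst ((relativeUniversalChains P).d 1 0) relativeToK).hom x)).trans h₁
  · exact (congr($(biprod.lift_snd ((relativeUniversalChains P).d 1 0) relativeToK).hom x)).trans h₂

lemma relativeToK_eq_zero_iff (a : (universalChains G).X 1) :
    relativeToK.hom ((translates P).projection 1 a) = 0 ↔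
      labelSum P ((universalChains G).d 1 0 a) = 0 := by
  rw [← relativeEdgeMap_projection]
  exact ⟨fun h => congrArg Subtype.val h, fun h => Subtype.ext h⟩

lemma d_comp_lift_relativeToK : (relativeUniversalChains P).d 2 1 ≫
    biprod.lift ((relativeUniversalChains P).d 1 0) relativeToK = 0 := by
  refine Rep.hom_ext (DFunLike.ext _ _ fun x => ?_)
  refine (lift_relativeToK_eq_zero_iff (((relativeUniversalChains P).d 2 1).hom x)).2 ⟨?_, ?_⟩
  · exact congr($((relativeUniversalChains P).d_comp_d 2 1 0).hom x)
  · obtain ⟨a, rfl⟩ := (translates P).surjective_projection 2 x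
    rw [← InvariantSubcomplex.projection_d, relativeToK_eq_zero_iff]
    have h := congr($((universalChains G).d_comp_d 2 1 0) a)
    exact (congrArg (labelSum P) h).trans (map_zero _)

lemma exact_d_lift_relativeToK : (ShortComplex.mk _ _ d_comp_lift_relativeToK).Exact := by
  refine Rep.shortComplex_exact _ _ _ fun x hx => ?_
  obtain ⟨h₁, h₂⟩ := (lift_relativeToK_eq_zero_iff x).1 hx
  obtain ⟨a, rfl⟩ := (translates P).surjective_projection 1 x
  exact exists_relative_d_eq_one P a h₁ ((relativeToK_eq_zero_iff a).1 h₂)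

instance (n : ℕ) : Projective ((relativeUniversalChains P).X n) :=
  (translates P).projective_relativeComplex eq_one_of_smul_singular_eq n

lemma nonempty_homology_Bbar_iso (n : ℕ) :
    Nonempty (Bbar.homology n ≅ relativeHomology G P n) := by
  have : Epi toK := (Rep.epi_iff_surjective _).2 surjective_toK
  -- There are no generators in degree 0, because `pos` would give 1 ≤ 0.
  have hC₀ : IsZero (Cbar.X 0) := (IsZero.iff_id_eq_zero _).2 <|
    Rep.ofMulAction_hom_ext fun α : Generator 0 => absurd α.pos (by decide)
  have wc : Cbar.d 2 1 ≫ toK = 0 := by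
    ext x
    exact (exact_Cbar_toK _).2 ⟨x, rfl⟩
  obtain ⟨φ, _⟩ := ChainComplex.exists_quasiIso_of_homology_concentrated_in_one
    (C := Cbar) (D := relativeUniversalChains P) hC₀ toK wc
    (Rep.shortComplex_exact _ _ _ fun x hx => (exact_Cbar_toK x).1 hx)
    (fun n => Rep.shortComplex_exact _ _ _ fun x hx => (exact_Cbar n x).1 hx)
    relativeToK d_comp_lift_relativeToK exact_d_lift_relativeToK
    (fun n => Rep.shortComplex_exact _ _ _ fun x hx => exists_relative_d_eq P n x hx)
  obtain ⟨e⟩ := ChainComplex.nonempty_homology_map_iso (Rep.coinvariantsFunctor ℤ G) φ n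
  obtain ⟨e'⟩ := nonempty_relativeChains_iso P
  exact ⟨e ≪≫ ((HomologicalComplex.homologyFunctor _ _ n).mapIso e').symm⟩

end TruncatedComplex

end

theorem mainTheorem7 :
    (∀ n : ℕ, Module.Free (MonoidAlgebra ℤ TruncatedComplex.G)
      (TruncatedComplex.Cbar.X n).ρ.asModule) ∧
    Function.Surjective TruncatedComplex.toK.hom ∧
    Function.Exact (TruncatedComplex.Cbar.d 2 1).hom TruncatedComplex.toK.hom ∧
    (∀ n : ℕ, Function.Exact (TruncatedComplex.Cbar.d (n + 3) (n + 2)).hom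
      (TruncatedComplex.Cbar.d (n + 2) (n + 1)).hom) ∧
    (∀ n : ℕ, Nonempty (TruncatedComplex.Bbar.homology n ≅
      TruncatedComplex.relativeHomology TruncatedComplex.G TruncatedComplex.P n)) :=
  ⟨TruncatedComplex.free_Cbar, TruncatedComplex.surjective_toK, TruncatedComplex.exact_Cbar_toK,
    TruncatedComplex.exact_Cbar, TruncatedComplex.nonempty_homology_Bbar_iso⟩
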